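/- Let $N\ge 1$, let $\Omega\subset\mathbb R^N$ be a bounded domain (open, connected, non-empty) and let $1<p<\infty$. Let $W^{1,p}_0(\Omega)$ be the closure of $C_c^\infty(\Omega)$ in $W^{1,p}(\Omega)$, with the norm $\|u\|_{1,p}=(\|u\|_p^p+\|\nabla u\|_p^p)^{1/p}$, and let $W^{-1,p'}(\Omega)$ be its dual, with duality pairing $\langle\cdot,\cdot\rangle$. Let $h\in W^{-1,p'}(\Omega)$, let $f:\Omega\times\mathbb R\to\mathbb R$ be a Carathéodory function such that $$\sup_{|s|\le R}|f(\cdot,s)|\in L^1_{loc}(\Omega)\qquad\text{for all }R>0,$$ and put $F(x,s)=\int_0^s f(x,t)\,dt$. For $u\in W^{1,p}_0(\Omega)$ let $\Psi(u)=\int_\Omega F(x,u)\,dx\in[-\infty,+\infty]$, with the convention that $\int_\Omega -F(x,u)\,dx=+\infty$ (that is, $\Psi(u)=-\infty$) if the positive and the negative part of $F(x,u)$ both have infinite integral, and let $$\Phi(u)=\frac1p\int_\Omega|\nabla u|^p\,dx-\Psi(u)-\langle h,u\rangle\in[-\infty,+\infty].$$ For a metric space $E$ and $\varphi:E\to[-\infty,+\infty]$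 let $\operatorname{epi}(\varphi)=\{(w,\mu)\in E\times\mathbb R:\varphi(w)\le\mu\}$, with the metric $(\operatorname{dist}(w,w')^2+(\mu-\mu')^2)^{1/2}$. A point $u\in E$ with $\varphi(u)\in\mathbb R$ is called $\delta$-regular ($\delta>0$) if there are $\sigma>0$ and a continuous map $\nu:(B_\sigma(u,\varphi(u))\cap\operatorname{epi}(\varphi))\times[0,\sigma]\to E$ with $\operatorname{dist}(\nu((w,\mu),t),w)\le t$ and $\varphi(\nu((w,\mu),t))\le\mu-\delta t$ for all $(w,\mu)$ and $t$. The weak slope $|d\varphi|(u)$ is the supremum of all $\delta>0$ such that $u$ is $\delta$-regular ($0$ if there are none), and $u$ is a critical point of $\varphi$ (in the sense of Degiovanni and Marzocchi) if $\varphi(u)\in\mathbb R$ and $|d\varphi|(u)=0$. For $u\in W^{1,p}_0(\Omega)$ let $A_u=\{v\in W^{1,p}_0(\Omega): f(x,u)v\in L^1(\Omega)\}$, and let $V_u$ be the set of the bounded $v\in W^{1,p}_0(\Omega)$ that vanish a.e. outside some compact subset of $\Omega$ and are such that $u\in L^\infty(\{v\ne0\})$. **Theorem.** Let $u\in W^{1,p}_0(\Omega)$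 be a critical point of $\Phi$ such that $\Psi(u)\in\mathbb R$. Then $u$ is a weak solution of $$-\Delta_p u=f(x,u)+h\ \text{ in }\Omega,\qquad u=0\ \text{ on }\partial\Omega .$$ That is: $f(x,u)\in W^{-1,p'}(\Omega)$ in the extended sense that $$\sup\Big\{\int_\Omega f(x,u)v\,dx:\ v\in A_u,\ \|v\|_{1,p}\le1\Big\}<+\infty;$$ $V_u\subset A_u$, and the functional $v\mapsto\int_\Omega f(x,u)v\,dx$ on $V_u$ has exactly one continuous linear extension $T$ to $W^{1,p}_0(\Omega)$; and, $f(x,u)$ being identified with $T$, the equation holds in $W^{-1,p'}(\Omega)$: $$\int_\Omega|\nabla u|^{p-2}\nabla u\cdot\nabla v\,dx=\langle T,v\rangle+\langle h,v\rangle\qquad\text{for all }v\in W^{1,p}_0(\Omega).$$ Moreover, $$\int_\Omega|\nabla u|^{p-2}\nabla u\cdot\nabla v\,dx=\int_\Omega f(x,u)v\,dx+\langle h,v\rangle\qquad\text{for all }v\in W^{1,p}_0(\Omega)\text{ with }f(x,u)v\in L^1(\Omega).$$ -/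

import Mathlib

open MeasureTheory Set
open scoped ENNReal ContDiff Gradient

noncomputable section

namespace PLap

/-! ### The Sobolev space `W₀^{1,p}(Ω)` -/

/-- The space `L^p(Ω) × L^p(Ω; ℝ^N)` of pairs `(u, G)` with the norm
`(‖u‖_p ^ p + ‖G‖_p ^ p) ^ (1 / p)`. -/
abbrev LpPair {N : ℕ} (Ω : Set (EuclideanSpace ℝ (Fin N))) (p : ℝ≥0∞) : Type :=
  WithLp p (Lp ℝ p (volume.restrict Ω) × Lp (EuclideanSpace ℝ (Fin N)) p (volume.restrict Ω))

/-- `φ ∈ C_c^∞(Ω)`. -/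
structure IsTest {N : ℕ} (Ω : Set (EuclideanSpace ℝ (Fin N)))
    (φ : EuclideanSpace ℝ (Fin N) → ℝ) : Prop where
  smooth : ContDiff ℝ ∞ φ
  compact : HasCompactSupport φ
  supp : tsupport φ ⊆ Ω

/-- The subspace of the pairs `(φ, ∇φ)` with `φ ∈ C_c^∞(Ω)`. -/
def testPairs {N : ℕ} (Ω : Set (EuclideanSpace ℝ (Fin N))) (p : ℝ≥0∞) [Fact (1 ≤ p)] :
    Submodule ℝ (LpPair Ω p) where
  carrier := {w | ∃ φ : EuclideanSpace ℝ (Fin N) → ℝ, IsTest Ω φ ∧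
    w.fst =ᵐ[volume.restrict Ω] φ ∧ w.snd =ᵐ[volume.restrict Ω] ∇ φ}
  zero_mem' := by
    refine ⟨0, ⟨contDiff_const, HasCompactSupport.zero, by simp [tsupport]⟩, ?_, ?_⟩
    · exact Lp.coeFn_zero _ _ _
    · refine (Lp.coeFn_zero _ _ _).trans (Filter.Eventually.of_forall fun x => ?_)
      simp [gradient]
  add_mem' := by
    rintro a b ⟨φ, hφ, ha, ha'⟩ ⟨ψ, hψ, hb, hb'⟩
    refine ⟨φ + ψ, ⟨hφ.smooth.add hψ.smooth, hφ.compact.add hψ.compact,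
      (tsupport_add φ ψ).trans (union_subset hφ.supp hψ.supp)⟩, ?_, ?_⟩
    · exact (Lp.coeFn_add a.fst b.fst).trans (ha.add hb)
    · refine (Lp.coeFn_add a.snd b.snd).trans ((ha'.add hb').trans
        (Filter.Eventually.of_forall fun x => ?_))
      have h1 := hφ.smooth.differentiable (by simp) x
      have h2 := hψ.smooth.differentiable (by simp) x
      simp [gradient, fderiv_add h1 h2]
  smul_mem' := by
    rintro c a ⟨φ, hφ, ha, ha'⟩
    refine ⟨c • φ, ⟨hφ.smooth.const_smul c, hφ.compact.smul_left (f := fun _ => c),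
      (tsupport_smul_subset_right (fun _ => c) φ).trans hφ.supp⟩, ?_, ?_⟩
    · exact (Lp.coeFn_smul c a.fst).trans (ha.const_smul c)
    · refine (Lp.coeFn_smul c a.snd).trans ((ha'.const_smul c).trans
        (Filter.Eventually.of_forall fun x => ?_))
      have h1 := hφ.smooth.differentiable (by simp) x
      simp [gradient, fderiv_const_smul h1 c]

/-- `W₀^{1,p}(Ω)`, the closure of `C_c^∞(Ω)` in `W^{1,p}(Ω)`: a function `u` is represented by
the pair `(u, ∇u)`, where `∇u` is its weak gradient (weak gradients pass to limits in `L^p`), and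
the norm is the usual one, `‖u‖_{1,p} = (‖u‖_p ^ p + ‖∇u‖_p ^ p) ^ (1 / p)`. -/
abbrev W0 {N : ℕ} (Ω : Set (EuclideanSpace ℝ (Fin N))) (p : ℝ≥0∞) [Fact (1 ≤ p)] :
    Submodule ℝ (LpPair Ω p) :=
  (testPairs Ω p).topologicalClosure

section
variable {N : ℕ} {Ω : Set (EuclideanSpace ℝ (Fin N))} {p : ℝ≥0∞} [Fact (1 ≤ p)]

/-- The function underlying an element of `W₀^{1,p}(Ω)`. -/
def fn (u : W0 Ω p) : EuclideanSpace ℝ (Fin N) → ℝ := (u : LpPair Ω p).fst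

/-- The weak gradient of an element of `W₀^{1,p}(Ω)`. -/
def grad (u : W0 Ω p) : EuclideanSpace ℝ (Fin N) → EuclideanSpace ℝ (Fin N) :=
  (u : LpPair Ω p).snd

end

/-! ### The weak slope -/

/-- The part of the epigraph of `f` in the open ball of center `(u, r)` and radius `σ`, for the
metric `((dist w u) ^ 2 + (μ - r) ^ 2) ^ (1 / 2)`. -/
def epiBall {E : Type*} [MetricSpace E] (f : E → EReal) (u : E) (r σ : ℝ) : Set (E × ℝ) :=
  {q | f q.1 ≤ (q.2 : EReal) ∧ √((dist q.1 u) ^ 2 + (q.2 - r) ^ 2) < σ}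

/-- `f u` is a real number and `u` is a `δ`-regular point of `f`. -/
def IsDeltaRegular {E : Type*} [MetricSpace E] (f : E → EReal) (u : E) (δ : ℝ) : Prop :=
  ∃ r : ℝ, f u = (r : EReal) ∧ ∃ σ : ℝ, 0 < σ ∧ ∃ ν : (E × ℝ) × ℝ → E,
    ContinuousOn ν (epiBall f u r σ ×ˢ Icc 0 σ) ∧
    ∀ q ∈ epiBall f u r σ, ∀ t ∈ Icc (0 : ℝ) σ,
      dist (ν (q, t)) q.1 ≤ t ∧ f (ν (q, t)) ≤ ((q.2 - δ * t : ℝ) : EReal)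

/-- The weak slope `|df|(u)`, with values in `[0, ∞]` (it is `0` if there is no `δ > 0` for which
`u` is `δ`-regular). -/
def weakSlope {E : Type*} [MetricSpace E] (f : E → EReal) (u : E) : ℝ≥0∞ :=
  ⨆ (δ : ℝ) (_ : 0 < δ ∧ IsDeltaRegular f u δ), ENNReal.ofReal δ

/-- `u` is a critical point of `f` in the sense of Degiovanni and Marzocchi. -/
def IsCritical {E : Type*} [MetricSpace E] (f : E → EReal) (u : E) : Prop :=
  (∃ r : ℝ, f u = (r : EReal)) ∧ weakSlope f u = 0

/-! ### The problem -/

/-- `f : Ω × ℝ → ℝ` is a Carathéodory function. -/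
def IsCaratheodory {N : ℕ} (Ω : Set (EuclideanSpace ℝ (Fin N)))
    (f : EuclideanSpace ℝ (Fin N) → ℝ → ℝ) : Prop :=
  (∀ s : ℝ, AEMeasurable (fun x => f x s) (volume.restrict Ω)) ∧
    ∀ᵐ x ∂(volume.restrict Ω), Continuous (f x)

/-- `sup_{|s| ≤ R} |f(·, s)| ∈ L¹_loc(Ω)` for every `R > 0`. -/
def LocalSupIntegrable {N : ℕ} (Ω : Set (EuclideanSpace ℝ (Fin N)))
    (f : EuclideanSpace ℝ (Fin N) → ℝ → ℝ) : Prop :=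
  ∀ R : ℝ, 0 < R →
    LocallyIntegrableOn (fun x => ⨆ s : Icc (-R) R, |f x s|) Ω volume

/-- The integral of a real function with values in `[-∞, ∞]`, with the convention that it is
`+∞` as soon as the integral of the positive part is `+∞`. -/
def extIntegral {α : Type*} [MeasurableSpace α] (μ : Measure α) (g : α → ℝ) : EReal :=
  open scoped Classical in
  if ∫⁻ x, ENNReal.ofReal (g x) ∂μ = ⊤ then ⊤
  else ((∫⁻ x, ENNReal.ofReal (g x) ∂μ : ℝ≥0∞) : EReal)
    - ((∫⁻ x, ENNReal.ofReal (-g x) ∂μ : ℝ≥0∞) : EReal)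

/-- `F(x, s) = ∫₀ˢ f(x, t) dt`. -/
def primitive {X : Type*} (f : X → ℝ → ℝ) (x : X) (s : ℝ) : ℝ := ∫ t in (0 : ℝ)..s, f x t

section
variable {N : ℕ} {Ω : Set (EuclideanSpace ℝ (Fin N))} {p : ℝ≥0∞} [Fact (1 ≤ p)]

/-- `Ψ(u) = ∫_Ω F(x, u) dx`, where the convention of `extIntegral` is applied to `-F`. -/
def Psi (f : EuclideanSpace ℝ (Fin N) → ℝ → ℝ) (u : W0 Ω p) : EReal :=
  -extIntegral (volume.restrict Ω) (fun x => -primitive f x (fn u x))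

/-- The energy functional
`Φ(u) = (1/p) ∫_Ω |∇u|^p dx - ∫_Ω F(x, u) dx - ⟨h, u⟩` on `W₀^{1,p}(Ω)`. -/
def Phi (f : EuclideanSpace ℝ (Fin N) → ℝ → ℝ) (h : StrongDual ℝ (W0 Ω p)) (u : W0 Ω p) :
    EReal :=
  ((1 / p.toReal * ∫ x in Ω, ‖grad u x‖ ^ p.toReal : ℝ) : EReal) - Psi f u - (h u : EReal)

/-- `⟨-Δ_p u, v⟩ = ∫_Ω |∇u|^{p-2} ∇u · ∇v dx`. -/
def pLaplacePairing (u v : W0 Ω p) : ℝ :=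
  ∫ x in Ω, ‖grad u x‖ ^ (p.toReal - 2) * inner ℝ (grad u x) (grad v x)

/-- `A_u`, the set of the `v ∈ W₀^{1,p}(Ω)` with `f(x, u) v ∈ L¹(Ω)`. -/
def testA (f : EuclideanSpace ℝ (Fin N) → ℝ → ℝ) (u : W0 Ω p) : Set (W0 Ω p) :=
  {v | IntegrableOn (fun x => f x (fn u x) * fn v x) Ω volume}

/-- `V_u`, the set of the bounded `v ∈ W₀^{1,p}(Ω)` that vanish a.e. outside a compact subset
of `Ω` and for which `u` is essentially bounded on `{v ≠ 0}`. -/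
def testV (u : W0 Ω p) : Set (W0 Ω p) :=
  {v | (∃ C : ℝ, ∀ᵐ x ∂(volume.restrict Ω), |fn v x| ≤ C) ∧
    (∃ K : Set (EuclideanSpace ℝ (Fin N)), IsCompact K ∧ K ⊆ Ω ∧
      ∀ᵐ x ∂(volume.restrict Ω), x ∉ K → fn v x = 0) ∧
    ∃ M : ℝ, ∀ᵐ x ∂(volume.restrict Ω), fn v x ≠ 0 → |fn u x| ≤ M}

/-- `Λ u = sup { ∫_Ω f(x, u) v dx : v ∈ A_u, ‖v‖_{1,p} ≤ 1 }`. -/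
def Lam (f : EuclideanSpace ℝ (Fin N) → ℝ → ℝ) (u : W0 Ω p) : EReal :=
  ⨆ v ∈ {v : W0 Ω p | v ∈ testA f u ∧ ‖v‖ ≤ 1}, ((∫ x in Ω, f x (fn u x) * fn v x : ℝ) : EReal)

/-- `T ∈ W^{-1,p'}(Ω)` is a continuous linear extension of the functional
`φ ↦ ∫_Ω f(x, u) φ dx` (which is to be well defined on `V_u`) to `W₀^{1,p}(Ω)`. -/
def IsExtension (f : EuclideanSpace ℝ (Fin N) → ℝ → ℝ) (u : W0 Ω p)
    (T : StrongDual ℝ (W0 Ω p)) : Prop :=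
  ∀ v ∈ testV u, v ∈ testA f u ∧ T v = ∫ x in Ω, f x (fn u x) * fn v x

/-- `u` is a weak solution of `-Δ_p u = f(x, u) + h`: one has `Λ u < ∞`, that is,
`f(x, u) ∈ W^{-1,p'}(Ω)` in the extended sense, the functional `φ ↦ ∫_Ω f(x, u) φ dx` on `V_u`
has exactly one continuous linear extension `T` to `W₀^{1,p}(Ω)`, and the equation, in which
`f(x, u)` is read as `T`, holds in `W^{-1,p'}(Ω)`. -/
def IsWeakSolution (f : EuclideanSpace ℝ (Fin N) → ℝ → ℝ) (h : StrongDual ℝ (W0 Ω p))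
    (u : W0 Ω p) : Prop :=
  Lam f u < ⊤ ∧
  ∃ T : StrongDual ℝ (W0 Ω p),
    (IsExtension f u T ∧ ∀ T' : StrongDual ℝ (W0 Ω p), IsExtension f u T' → T' = T) ∧
    ∀ v : W0 Ω p, pLaplacePairing u v = T v + h v

end

end PLap

end

noncomputable section

namespace PLap

open Filter Topology BoundedContinuousFunction

/-! ### Dominated convergence in `L^p` and multiplication by bounded continuous functions -/

section Lp

variable {α F : Type*} [MeasurableSpace α] {μ : Measure α} {p : ℝ≥0∞} [Fact (1 ≤ p)]
  [NormedAddCommGroup F]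

/-! `Φ` may take infinite values arbitrarily close to `u`, but it has controlled increments along
suitable fields. Let `v ∈ V_u`, with `|v| ≤ C`, and `|u| ≤ R` on `{v ≠ 0}`. With a smooth cutoff
`β`, the field `Z(w) = β(w/R) β(v/C) v` is continuous on `W₀^{1,p}(Ω)`, takes the value `v` at `w =
u`, is bounded, and vanishes off a fixed compact subset of `Ω` and wherever `|w| ≥ 2R`. Along `w + t
Z(w)` only bounded arguments of `f` over that compact set matter. Hence `Ψ` changes by a finite
amount, whether or not `Ψ(w)` is finite, and by dominated convergence the increment divided by `t`
tends to `∫ f(x,u) v` as `(w, t) → (u, 0)`. The energy is convex, so its slope at one fixed `s > 0`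
bounds its slopes at all smaller `t`, and that bound is continuous in `w`.

If `⟨-Δ_p u, v⟩ - ∫ f(x,u) v - ⟨h, v⟩` were negative, then after scaling `v` the map `(w, μ, t) ↦ w
+ t Z(w)` would make `u` a `δ`-regular point (`BoundedField.isDeltaRegular`), against criticality.
Applied to `v` and `-v`, this gives the equation on `V_u` (`eq_of_isCritical`). So `T = -Δ_p u - h`
is an extension, and the only one because `V_u` is dense (`dense_testV`).

The passage from `V_u` to `A_u` is in the spirit of Brezis and Browder (`eq_integral_of_mem_testA`):
`v ∈ A_u` is approximated in norm by bounded, compactly supported functions that stay below `|v|`,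
so that `|f(x,u) v|` dominates the integrals. A smooth function of two variables, small when either
one is small, replaces the usual truncation by minima.

All compositions have the form `c(w₁, w₂) w₂` with `c(s,t) t` smooth and with bounded derivatives:
they preserve test functions and are continuous in norm, hence preserve the closure together with
the chain rule. -/

theorem Lp_tendsto_of_dominated (hp : p ≠ ⊤) {g : ℕ → Lp F p μ} {g₀ : Lp F p μ} {B : α → ℝ}
    (hB : MemLp B p μ) (bound : ∀ n, ∀ᵐ x ∂μ, ‖g n x‖ ≤ B x)
    (lim : ∀ᵐ x ∂μ, Tendsto (fun n => g n x) atTop (𝓝 (g₀ x))) :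
    Tendsto g atTop (𝓝 g₀) := by
  have hp0 : p ≠ 0 := (zero_lt_one.trans_le Fact.out).ne'
  have hpt : 0 < p.toReal := ENNReal.toReal_pos hp0 hp
  rw [Lp.tendsto_Lp_iff_tendsto_eLpNorm']
  have key : Tendsto (fun n => ∫⁻ x, ‖(⇑(g n) - ⇑g₀) x‖ₑ ^ p.toReal ∂μ) atTop
      (𝓝 (∫⁻ _, (0 : ℝ≥0∞) ∂μ)) := by
    refine tendsto_lintegral_of_dominated_convergence'
      (fun x => ‖(2 : ℝ) * B x‖ₑ ^ p.toReal) (fun n => ?_) (fun n => ?_) ?_ ?_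
    · exact (((Lp.aestronglyMeasurable _).sub (Lp.aestronglyMeasurable _)).enorm).pow_const _
    · filter_upwards [bound n, lim, ae_all_iff.2 bound] with x hx hl hb
      have h0 : ‖g₀ x‖ ≤ B x := le_of_tendsto hl.norm (Eventually.of_forall hb)
      refine ENNReal.rpow_le_rpow ?_ hpt.le
      rw [← ofReal_norm, ← ofReal_norm]
      refine ENNReal.ofReal_le_ofReal ?_
      rw [Pi.sub_apply]
      calc ‖g n x - g₀ x‖ ≤ ‖g n x‖ + ‖g₀ x‖ := norm_sub_le _ _
        _ ≤ 2 * B x := by linarith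
        _ ≤ ‖2 * B x‖ := le_abs_self _
    · have := (hB.const_mul 2).2
      exact (lintegral_rpow_enorm_lt_top_of_eLpNorm_lt_top hp0 hp this).ne
    · filter_upwards [lim] with x hx
      have h1 : Tendsto (fun n => ‖(⇑(g n) - ⇑g₀) x‖ₑ) atTop (𝓝 0) := by
        have : Tendsto (fun n => g n x - g₀ x) atTop (𝓝 0) := by
          simpa using hx.sub_const (g₀ x)
        simpa using this.enorm
      have h2 := (ENNReal.continuous_rpow_const (y := p.toReal)).tendsto 0
      rw [ENNReal.zero_rpow_of_pos hpt] at h2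
      exact h2.comp h1
  rw [lintegral_zero] at key
  have h3 := ((ENNReal.continuous_rpow_const (y := 1 / p.toReal)).tendsto 0).comp key
  rw [ENNReal.zero_rpow_of_pos (by positivity)] at h3
  refine h3.congr fun n => ?_
  rw [eLpNorm_eq_lintegral_rpow_enorm_toReal hp0 hp]
  rfl

theorem Lp_exists_subseq_ae {g : ℕ → Lp F p μ} {g₀ : Lp F p μ} (h : Tendsto g atTop (𝓝 g₀)) :
    ∃ ns : ℕ → ℕ, StrictMono ns ∧
      ∀ᵐ x ∂μ, Tendsto (fun n => g (ns n) x) atTop (𝓝 (g₀ x)) :=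
  (tendstoInMeasure_of_tendsto_Lp h).exists_seq_tendsto_ae

variable [NormedSpace ℝ F]

omit [Fact (1 ≤ p)] in
theorem memLp_nemSmul (a : (ℝ × ℝ) →ᵇ ℝ) (w₁ w₂ : Lp ℝ p μ) (H : Lp F p μ) :
    MemLp (fun x => a (w₁ x, w₂ x) • H x) p μ := by
  refine (Lp.memLp H).of_le_mul (c := ‖a‖) ?_ (Eventually.of_forall fun x => ?_)
  · exact (a.continuous.comp_aestronglyMeasurable
      ((Lp.aestronglyMeasurable w₁).prodMk (Lp.aestronglyMeasurable w₂))).smul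
        (Lp.aestronglyMeasurable H)
  · rw [norm_smul]
    exact mul_le_mul_of_nonneg_right (a.norm_coe_le_norm _) (norm_nonneg _)

/-- The product of `H ∈ L^p` with the bounded function `a(w₁, w₂)`. -/
def nemSmul (a : (ℝ × ℝ) →ᵇ ℝ) (w₁ w₂ : Lp ℝ p μ) (H : Lp F p μ) : Lp F p μ :=
  (memLp_nemSmul a w₁ w₂ H).toLp _

omit [Fact (1 ≤ p)] in
theorem coeFn_nemSmul (a : (ℝ × ℝ) →ᵇ ℝ) (w₁ w₂ : Lp ℝ p μ) (H : Lp F p μ) :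
    nemSmul a w₁ w₂ H =ᵐ[μ] fun x => a (w₁ x, w₂ x) • H x :=
  MemLp.coeFn_toLp _

omit [Fact (1 ≤ p)] in
theorem nemSmul_sub (a : (ℝ × ℝ) →ᵇ ℝ) (w₁ w₂ : Lp ℝ p μ) (H H' : Lp F p μ) :
    nemSmul a w₁ w₂ (H - H') = nemSmul a w₁ w₂ H - nemSmul a w₁ w₂ H' := by
  ext1
  filter_upwards [coeFn_nemSmul a w₁ w₂ (H - H'), coeFn_nemSmul a w₁ w₂ H,
    coeFn_nemSmul a w₁ w₂ H', Lp.coeFn_sub H H',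
    Lp.coeFn_sub (nemSmul a w₁ w₂ H) (nemSmul a w₁ w₂ H')] with x h1 h2 h3 h4 h5
  rw [h1, h5, Pi.sub_apply, h2, h3, h4, Pi.sub_apply, smul_sub]

omit [Fact (1 ≤ p)] in
theorem norm_nemSmul_le (a : (ℝ × ℝ) →ᵇ ℝ) (w₁ w₂ : Lp ℝ p μ) (H : Lp F p μ) :
    ‖nemSmul a w₁ w₂ H‖ ≤ ‖a‖ * ‖H‖ := by
  refine Lp.norm_le_mul_norm_of_ae_le_mul ?_
  filter_upwards [coeFn_nemSmul a w₁ w₂ H] with x hx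
  rw [hx, norm_smul]
  exact mul_le_mul_of_nonneg_right (a.norm_coe_le_norm _) (norm_nonneg _)

/-- The change in `H` is controlled by the sup norm of `a`. With `H` fixed, the coefficients
converge a.e. along subsequences, and `‖a‖ |H|` dominates. -/
theorem continuous_nemSmul (hp : p ≠ ⊤) (a : (ℝ × ℝ) →ᵇ ℝ) :
    Continuous fun q : Lp ℝ p μ × Lp ℝ p μ × Lp F p μ => nemSmul a q.1 q.2.1 q.2.2 := by
  rw [continuous_iff_seqContinuous]
  intro q q₀ hq
  have h1 : Tendsto (fun n => (q n).1) atTop (𝓝 q₀.1) := (continuous_fst.tendsto _).comp hq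
  have h2 : Tendsto (fun n => (q n).2.1) atTop (𝓝 q₀.2.1) :=
    ((continuous_fst.comp continuous_snd).tendsto _).comp hq
  have h3 : Tendsto (fun n => (q n).2.2) atTop (𝓝 q₀.2.2) :=
    ((continuous_snd.comp continuous_snd).tendsto _).comp hq
  have hA : Tendsto (fun n => nemSmul a (q n).1 (q n).2.1 ((q n).2.2 - q₀.2.2)) atTop (𝓝 0) := by
    refine squeeze_zero_norm (fun n => norm_nemSmul_le a _ _ _) ?_
    have : Tendsto (fun n => (q n).2.2 - q₀.2.2) atTop (𝓝 0) := by
      simpa using h3.sub_const q₀.2.2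
    simpa using this.norm.const_mul ‖a‖
  have hB : Tendsto (fun n => nemSmul a (q n).1 (q n).2.1 q₀.2.2) atTop
      (𝓝 (nemSmul a q₀.1 q₀.2.1 q₀.2.2)) := by
    refine tendsto_of_subseq_tendsto fun ns hns => ?_
    obtain ⟨m₁, hm₁, hl₁⟩ := Lp_exists_subseq_ae (h1.comp hns)
    obtain ⟨m₂, hm₂, hl₂⟩ := Lp_exists_subseq_ae ((h2.comp hns).comp hm₁.tendsto_atTop)
    refine ⟨m₁ ∘ m₂, Lp_tendsto_of_dominated hp ((Lp.memLp q₀.2.2).norm.const_mul ‖a‖)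
      (fun n => ?_) ?_⟩
    · filter_upwards [coeFn_nemSmul a (q (ns ((m₁ ∘ m₂) n))).1 (q (ns ((m₁ ∘ m₂) n))).2.1 q₀.2.2]
        with x hx
      rw [hx, norm_smul]
      exact mul_le_mul_of_nonneg_right (a.norm_coe_le_norm _) (norm_nonneg _)
    · filter_upwards [hl₁, hl₂, coeFn_nemSmul a q₀.1 q₀.2.1 q₀.2.2, ae_all_iff.2 fun n =>
        coeFn_nemSmul a (q (ns ((m₁ ∘ m₂) n))).1 (q (ns ((m₁ ∘ m₂) n))).2.1 q₀.2.2]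
        with x h1 h2 h3 h4
      rw [h3]
      simp only [h4]
      refine Tendsto.smul ?_ tendsto_const_nhds
      refine (a.continuous.tendsto _).comp (Tendsto.prodMk_nhds ?_ ?_)
      · exact h1.comp hm₂.tendsto_atTop
      · exact h2
  have := hA.add hB
  simp only [zero_add] at this
  refine this.congr fun n => ?_
  rw [nemSmul_sub]
  exact sub_add_cancel _ _

end Lp

/-! ### Smooth compositions in `W₀^{1,p}(Ω)` -/

/-- A bounded smooth function `c(s, t)` such that `c(s, t) t` has bounded partial derivatives
`a` and `b`. -/
structure Multiplier where
  c : (ℝ × ℝ) →ᵇ ℝ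
  a : (ℝ × ℝ) →ᵇ ℝ
  b : (ℝ × ℝ) →ᵇ ℝ
  smooth : ContDiff ℝ ∞ c
  deriv : ∀ q : ℝ × ℝ, HasFDerivAt (fun q : ℝ × ℝ => c q * q.2)
    (a q • ContinuousLinearMap.fst ℝ ℝ ℝ + b q • ContinuousLinearMap.snd ℝ ℝ ℝ) q

section

variable {N : ℕ} {Ω : Set (EuclideanSpace ℝ (Fin N))} {p : ℝ≥0∞} [Fact (1 ≤ p)]

theorem LpPair_tendsto {w : ℕ → LpPair Ω p} {w₀ : LpPair Ω p}
    (h1 : Tendsto (fun n => (w n).fst) atTop (𝓝 w₀.fst))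
    (h2 : Tendsto (fun n => (w n).snd) atTop (𝓝 w₀.snd)) : Tendsto w atTop (𝓝 w₀) :=
  ((WithLp.prod_continuous_toLp p _ _).tendsto (w₀.fst, w₀.snd)).comp (h1.prodMk_nhds h2)

/-- The pair of `c(w₁, w₂) w₂` and its formal gradient. -/
def Multiplier.act (M : Multiplier) (w₁ w₂ : LpPair Ω p) : LpPair Ω p :=
  WithLp.toLp p (nemSmul M.c w₁.fst w₂.fst w₂.fst,
    nemSmul M.a w₁.fst w₂.fst w₁.snd + nemSmul M.b w₁.fst w₂.fst w₂.snd)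

theorem Multiplier.continuous_act (hp : p ≠ ⊤) (M : Multiplier) :
    Continuous fun q : LpPair Ω p × LpPair Ω p => M.act q.1 q.2 := by
  refine (WithLp.prod_continuous_toLp p _ _).comp ?_
  have f1 : Continuous fun q : LpPair Ω p × LpPair Ω p => q.1.fst :=
    (WithLp.continuous_fst p _ _).comp continuous_fst
  have f2 : Continuous fun q : LpPair Ω p × LpPair Ω p => q.2.fst :=
    (WithLp.continuous_fst p _ _).comp continuous_snd
  have g1 : Continuous fun q : LpPair Ω p × LpPair Ω p => q.1.snd :=
    (WithLp.continuous_snd p _ _).comp continuous_fst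
  have g2 : Continuous fun q : LpPair Ω p × LpPair Ω p => q.2.snd :=
    (WithLp.continuous_snd p _ _).comp continuous_snd
  exact ((continuous_nemSmul hp M.c).comp (f1.prodMk (f2.prodMk f2))).prodMk
    (((continuous_nemSmul hp M.a).comp (f1.prodMk (f2.prodMk g1))).add
      ((continuous_nemSmul hp M.b).comp (f1.prodMk (f2.prodMk g2))))

theorem Multiplier.gradient_comp (M : Multiplier) {φ ψ : EuclideanSpace ℝ (Fin N) → ℝ}
    {x : EuclideanSpace ℝ (Fin N)} (hφ : DifferentiableAt ℝ φ x) (hψ : DifferentiableAt ℝ ψ x) :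
    ∇ (fun y => M.c (φ y, ψ y) * ψ y) x = M.a (φ x, ψ x) • ∇ φ x + M.b (φ x, ψ x) • ∇ ψ x := by
  have h := (M.deriv (φ x, ψ x)).comp x (hφ.hasFDerivAt.prodMk hψ.hasFDerivAt)
  have h' : HasFDerivAt (fun y => M.c (φ y, ψ y) * ψ y)
      (M.a (φ x, ψ x) • fderiv ℝ φ x + M.b (φ x, ψ x) • fderiv ℝ ψ x) x := by
    refine h.congr_fderiv ?_
    ext v
    simp
  simp [gradient, h'.fderiv]

theorem Multiplier.isTest_comp (M : Multiplier) {φ ψ : EuclideanSpace ℝ (Fin N) → ℝ}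
    (hφ : IsTest Ω φ) (hψ : IsTest Ω ψ) : IsTest Ω (fun y => M.c (φ y, ψ y) * ψ y) :=
  ⟨(M.smooth.comp (hφ.smooth.prodMk hψ.smooth)).mul hψ.smooth, hψ.compact.mul_left,
    (tsupport_mul_subset_right).trans hψ.supp⟩

theorem Multiplier.act_mem_testPairs (M : Multiplier) {w₁ w₂ : LpPair Ω p}
    (h₁ : w₁ ∈ testPairs Ω p) (h₂ : w₂ ∈ testPairs Ω p) : M.act w₁ w₂ ∈ testPairs Ω p := by
  obtain ⟨φ, hφ, ha, ha'⟩ := h₁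
  obtain ⟨ψ, hψ, hb, hb'⟩ := h₂
  refine ⟨_, M.isTest_comp hφ hψ, ?_, ?_⟩
  · filter_upwards [coeFn_nemSmul M.c w₁.fst w₂.fst w₂.fst, ha, hb] with x h1 h2 h3
    rw [h2, h3] at h1
    exact h1
  · filter_upwards [coeFn_nemSmul M.a w₁.fst w₂.fst w₁.snd,
      coeFn_nemSmul M.b w₁.fst w₂.fst w₂.snd, ha, hb, ha', hb',
      Lp.coeFn_add (nemSmul M.a w₁.fst w₂.fst w₁.snd) (nemSmul M.b w₁.fst w₂.fst w₂.snd)]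
      with x h1 h2 h3 h4 h5 h6 h7
    rw [M.gradient_comp (hφ.smooth.differentiable (by simp) x)
      (hψ.smooth.differentiable (by simp) x)]
    refine h7.trans ?_
    rw [Pi.add_apply, h1, h2, h3, h4, h5, h6]

/-- The chain rule holds classically on test functions, and a continuous map that preserves a set
also preserves its closure. -/
theorem Multiplier.act_mem (hp : p ≠ ⊤) (M : Multiplier) (w₁ w₂ : W0 Ω p) :
    M.act (w₁ : LpPair Ω p) (w₂ : LpPair Ω p) ∈ W0 Ω p :=
  map_mem_closure₂ (M.continuous_act hp) w₁.2 w₂.2 fun _ h₁ _ h₂ => M.act_mem_testPairs h₁ h₂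

/-- The composition `c(w₁, w₂) w₂` in `W₀^{1,p}(Ω)`. -/
def Multiplier.app (M : Multiplier) (hp : p ≠ ⊤) (w₁ w₂ : W0 Ω p) : W0 Ω p :=
  ⟨M.act w₁ w₂, M.act_mem hp w₁ w₂⟩

theorem Multiplier.continuous_app (M : Multiplier) (hp : p ≠ ⊤) :
    Continuous fun q : W0 Ω p × W0 Ω p => M.app hp q.1 q.2 :=
  ((M.continuous_act hp).comp ((continuous_subtype_val.comp continuous_fst).prodMk
    (continuous_subtype_val.comp continuous_snd))).subtype_mk _

theorem Multiplier.fn_app (M : Multiplier) (hp : p ≠ ⊤) (w₁ w₂ : W0 Ω p) :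
    fn (M.app hp w₁ w₂) =ᵐ[volume.restrict Ω] fun x => M.c (fn w₁ x, fn w₂ x) * fn w₂ x :=
  coeFn_nemSmul M.c _ _ _

theorem Multiplier.grad_app (M : Multiplier) (hp : p ≠ ⊤) (w₁ w₂ : W0 Ω p) :
    grad (M.app hp w₁ w₂) =ᵐ[volume.restrict Ω] fun x =>
      M.a (fn w₁ x, fn w₂ x) • grad w₁ x + M.b (fn w₁ x, fn w₂ x) • grad w₂ x := by
  filter_upwards [coeFn_nemSmul M.a (w₁ : LpPair Ω p).fst (w₂ : LpPair Ω p).fst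
      (w₁ : LpPair Ω p).snd,
    coeFn_nemSmul M.b (w₁ : LpPair Ω p).fst (w₂ : LpPair Ω p).fst (w₂ : LpPair Ω p).snd,
    Lp.coeFn_add (nemSmul M.a (w₁ : LpPair Ω p).fst (w₂ : LpPair Ω p).fst (w₁ : LpPair Ω p).snd)
      (nemSmul M.b (w₁ : LpPair Ω p).fst (w₂ : LpPair Ω p).fst (w₂ : LpPair Ω p).snd)]
    with x h1 h2 h3
  refine h3.trans ?_
  rw [Pi.add_apply, h1, h2]
  rfl

theorem memLp_fn (w : W0 Ω p) : MemLp (fn w) p (volume.restrict Ω) := Lp.memLp _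

theorem memLp_grad (w : W0 Ω p) : MemLp (grad w) p (volume.restrict Ω) := Lp.memLp _

theorem W0_ext {v w : W0 Ω p} (h1 : fn v =ᵐ[volume.restrict Ω] fn w)
    (h2 : grad v =ᵐ[volume.restrict Ω] grad w) : v = w := by
  apply Subtype.ext
  apply WithLp.ofLp_injective
  exact Prod.ext (Lp.ext h1) (Lp.ext h2)

theorem fn_add (v w : W0 Ω p) :
    fn (v + w) =ᵐ[volume.restrict Ω] fun x => fn v x + fn w x := Lp.coeFn_add _ _

theorem grad_add (v w : W0 Ω p) :
    grad (v + w) =ᵐ[volume.restrict Ω] fun x => grad v x + grad w x := Lp.coeFn_add _ _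

theorem fn_smul (c : ℝ) (v : W0 Ω p) :
    fn (c • v) =ᵐ[volume.restrict Ω] fun x => c * fn v x := Lp.coeFn_smul _ _

theorem grad_smul (c : ℝ) (v : W0 Ω p) :
    grad (c • v) =ᵐ[volume.restrict Ω] fun x => c • grad v x := Lp.coeFn_smul _ _

theorem fn_zero : fn (0 : W0 Ω p) =ᵐ[volume.restrict Ω] fun _ => 0 := Lp.coeFn_zero _ _ _

theorem grad_zero : grad (0 : W0 Ω p) =ᵐ[volume.restrict Ω] fun _ => 0 := Lp.coeFn_zero _ _ _

/-- The function underlying an element of `W₀^{1,p}(Ω)`, as a continuous linear map. -/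
def fnL : W0 Ω p →L[ℝ] Lp ℝ p (volume.restrict Ω) :=
  (WithLp.fstL p ℝ _ _).comp (W0 Ω p).subtypeL

/-- The weak gradient of an element of `W₀^{1,p}(Ω)`, as a continuous linear map. -/
def gradL : W0 Ω p →L[ℝ] Lp (EuclideanSpace ℝ (Fin N)) p (volume.restrict Ω) :=
  (WithLp.sndL p ℝ _ _).comp (W0 Ω p).subtypeL

theorem coeFn_gradL (w : W0 Ω p) : ⇑(gradL w) = grad w := rfl

theorem gradL_add_smul (w z : W0 Ω p) (t : ℝ) : gradL (w + t • z) = gradL w + t • gradL z := rfl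

theorem exists_subseq_fn {w : ℕ → W0 Ω p} {w₀ : W0 Ω p} (h : Tendsto w atTop (𝓝 w₀)) :
    ∃ ns : ℕ → ℕ, StrictMono ns ∧
      ∀ᵐ x ∂volume.restrict Ω, Tendsto (fun n => fn (w (ns n)) x) atTop (𝓝 (fn w₀ x)) := by
  have h' : Tendsto (fun n => fnL (w n)) atTop (𝓝 (fnL w₀)) := (fnL.continuous.tendsto w₀).comp h
  obtain ⟨ns, h₁, h₂⟩ := Lp_exists_subseq_ae h'
  refine ⟨ns, h₁, ?_⟩
  filter_upwards [h₂] with x hx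
  exact hx

/-- Dominated convergence for uniformly bounded multipliers. The limit is a pair `(g, G)` of
functions, which is thereby in `W₀^{1,p}(Ω)`. -/
theorem Multiplier.exists_tendsto_app (hp : p ≠ ⊤) (M : ℕ → Multiplier) (w₁ w₂ : W0 Ω p) {K : ℝ}
    (hc : ∀ n q, |(M n).c q| ≤ K)
    (hab : ∀ n, ∀ᵐ x ∂volume.restrict Ω,
      ‖(M n).a (fn w₁ x, fn w₂ x) • grad w₁ x + (M n).b (fn w₁ x, fn w₂ x) • grad w₂ x‖
        ≤ K * (‖grad w₁ x‖ + ‖grad w₂ x‖))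
    {g : EuclideanSpace ℝ (Fin N) → ℝ} {G : EuclideanSpace ℝ (Fin N) → EuclideanSpace ℝ (Fin N)}
    (hg : ∀ᵐ x ∂volume.restrict Ω,
      Tendsto (fun n => (M n).c (fn w₁ x, fn w₂ x) * fn w₂ x) atTop (𝓝 (g x)))
    (hG : ∀ᵐ x ∂volume.restrict Ω,
      Tendsto (fun n => (M n).a (fn w₁ x, fn w₂ x) • grad w₁ x +
        (M n).b (fn w₁ x, fn w₂ x) • grad w₂ x) atTop (𝓝 (G x))) :
    ∃ z : W0 Ω p, fn z =ᵐ[volume.restrict Ω] g ∧ grad z =ᵐ[volume.restrict Ω] G ∧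
      Tendsto (fun n => (M n).app hp w₁ w₂) atTop (𝓝 z) := by
  have hfn : ∀ᵐ x ∂volume.restrict Ω, ∀ n, fn ((M n).app hp w₁ w₂) x =
      (M n).c (fn w₁ x, fn w₂ x) * fn w₂ x := ae_all_iff.2 fun n => (M n).fn_app hp w₁ w₂
  have hgr : ∀ᵐ x ∂volume.restrict Ω, ∀ n, grad ((M n).app hp w₁ w₂) x =
      (M n).a (fn w₁ x, fn w₂ x) • grad w₁ x + (M n).b (fn w₁ x, fn w₂ x) • grad w₂ x :=
    ae_all_iff.2 fun n => (M n).grad_app hp w₁ w₂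
  have hB₁ : MemLp (fun x => K * ‖fn w₂ x‖) p (volume.restrict Ω) :=
    (memLp_fn w₂).norm.const_mul K
  have hB₂ : MemLp (fun x => K * (‖grad w₁ x‖ + ‖grad w₂ x‖)) p (volume.restrict Ω) :=
    ((memLp_grad w₁).norm.add (memLp_grad w₂).norm).const_mul K
  have b₁ : ∀ n, ∀ᵐ x ∂volume.restrict Ω, ‖fn ((M n).app hp w₁ w₂) x‖ ≤ K * ‖fn w₂ x‖ := by
    intro n
    filter_upwards [hfn] with x hx
    rw [hx n, norm_mul]
    exact mul_le_mul_of_nonneg_right (hc n _) (norm_nonneg _)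
  have b₂ : ∀ n, ∀ᵐ x ∂volume.restrict Ω,
      ‖grad ((M n).app hp w₁ w₂) x‖ ≤ K * (‖grad w₁ x‖ + ‖grad w₂ x‖) := by
    intro n
    filter_upwards [hgr, hab n] with x hx hx'
    rw [hx n]
    exact hx'
  have l₁ : ∀ᵐ x ∂volume.restrict Ω,
      Tendsto (fun n => fn ((M n).app hp w₁ w₂) x) atTop (𝓝 (g x)) := by
    filter_upwards [hfn, hg] with x hx hx'
    simpa only [hx] using hx'
  have l₂ : ∀ᵐ x ∂volume.restrict Ω,
      Tendsto (fun n => grad ((M n).app hp w₁ w₂) x) atTop (𝓝 (G x)) := by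
    filter_upwards [hgr, hG] with x hx hx'
    simpa only [hx] using hx'
  have hgm : MemLp g p (volume.restrict Ω) := by
    refine hB₁.of_le (aestronglyMeasurable_of_tendsto_ae atTop
      (fun n => (memLp_fn ((M n).app hp w₁ w₂)).1) l₁) ?_
    filter_upwards [l₁, ae_all_iff.2 b₁] with x h1 h2
    exact (le_of_tendsto h1.norm (Eventually.of_forall h2)).trans (le_abs_self _)
  have hGm : MemLp G p (volume.restrict Ω) := by
    refine hB₂.of_le (aestronglyMeasurable_of_tendsto_ae atTop
      (fun n => (memLp_grad ((M n).app hp w₁ w₂)).1) l₂) ?_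
    filter_upwards [l₂, ae_all_iff.2 b₂] with x h1 h2
    exact (le_of_tendsto h1.norm (Eventually.of_forall h2)).trans (le_abs_self _)
  let z : LpPair Ω p := WithLp.toLp p (hgm.toLp g, hGm.toLp G)
  have hz : Tendsto (fun n => ((M n).app hp w₁ w₂ : LpPair Ω p)) atTop (𝓝 z) := by
    refine LpPair_tendsto (Lp_tendsto_of_dominated hp hB₁ b₁ ?_)
      (Lp_tendsto_of_dominated hp hB₂ b₂ ?_)
    · filter_upwards [l₁, hgm.coeFn_toLp] with x h1 h2
      exact h2.symm ▸ h1
    · filter_upwards [l₂, hGm.coeFn_toLp] with x h1 h2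
      exact h2.symm ▸ h1
  have hzm : z ∈ W0 Ω p :=
    (testPairs Ω p).isClosed_topologicalClosure.mem_of_tendsto hz
      (Eventually.of_forall fun n => ((M n).app hp w₁ w₂).2)
  exact ⟨⟨z, hzm⟩, hgm.coeFn_toLp, hGm.coeFn_toLp, tendsto_subtype_rng.2 hz⟩

theorem Multiplier.tendsto_app (hp : p ≠ ⊤) (M : ℕ → Multiplier) (w₁ w₂ z : W0 Ω p) {K : ℝ}
    (hc : ∀ n q, |(M n).c q| ≤ K)
    (hab : ∀ n, ∀ᵐ x ∂volume.restrict Ω,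
      ‖(M n).a (fn w₁ x, fn w₂ x) • grad w₁ x + (M n).b (fn w₁ x, fn w₂ x) • grad w₂ x‖
        ≤ K * (‖grad w₁ x‖ + ‖grad w₂ x‖))
    (hg : ∀ᵐ x ∂volume.restrict Ω,
      Tendsto (fun n => (M n).c (fn w₁ x, fn w₂ x) * fn w₂ x) atTop (𝓝 (fn z x)))
    (hG : ∀ᵐ x ∂volume.restrict Ω,
      Tendsto (fun n => (M n).a (fn w₁ x, fn w₂ x) • grad w₁ x +
        (M n).b (fn w₁ x, fn w₂ x) • grad w₂ x) atTop (𝓝 (grad z x))) :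
    Tendsto (fun n => (M n).app hp w₁ w₂) atTop (𝓝 z) := by
  obtain ⟨z', h1, h2, h3⟩ := Multiplier.exists_tendsto_app hp M w₁ w₂ hc hab hg hG
  rwa [W0_ext h1 h2] at h3

end

/-! ### The two families of multipliers: cutoffs and pinching -/

/-- A smooth bump function on the line, equal to `1` on `[-1, 1]` and to `0` off `(-2, 2)`. -/
def bump : ContDiffBump (0 : ℝ) := ⟨1, 2, one_pos, one_lt_two⟩

theorem bump_eq_one {r : ℝ} (h : |r| ≤ 1) : bump r = 1 :=
  bump.one_of_mem_closedBall (by simpa [bump] using h)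

theorem bump_eq_zero {r : ℝ} (h : 2 ≤ |r|) : bump r = 0 :=
  bump.zero_of_le_dist (by simpa [bump] using h)

theorem abs_bump_le (r : ℝ) : |bump r| ≤ 1 := by
  rw [abs_of_nonneg bump.nonneg]
  exact bump.le_one

theorem contDiff_bump : ContDiff ℝ ∞ bump := bump.contDiff

theorem hasDerivAt_bump (r : ℝ) : HasDerivAt bump (deriv bump r) r :=
  ((contDiff_bump.differentiable (by simp)) r).hasDerivAt

theorem continuous_deriv_bump : Continuous (deriv bump) :=
  contDiff_bump.continuous_deriv (by simp)

theorem deriv_bump_eq_zero {r : ℝ} (h : 2 ≤ |r|) : deriv bump r = 0 := by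
  have : IsLocalMin bump r :=
    Eventually.of_forall fun x => by rw [bump_eq_zero h]; exact bump.nonneg
  exact this.deriv_eq_zero

theorem exists_deriv_bump_le : ∃ D : ℝ, ∀ r, ‖deriv bump r‖ ≤ D :=
  bump.hasCompactSupport.deriv.exists_bound_of_continuous continuous_deriv_bump

/-- A bound for the derivative of the bump function. -/
def bumpBound : ℝ := exists_deriv_bump_le.choose

theorem abs_deriv_bump_le (r : ℝ) : |deriv bump r| ≤ bumpBound := exists_deriv_bump_le.choose_spec r

theorem bumpBound_nonneg : 0 ≤ bumpBound := (abs_nonneg _).trans (abs_deriv_bump_le 0)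

theorem abs_bump_div_mul_le {C : ℝ} (hC : 0 < C) (t : ℝ) : |bump (t / C) * t| ≤ 2 * C := by
  by_cases h : 2 ≤ |t / C|
  · simp [bump_eq_zero h, hC.le]
  · rw [abs_div, abs_of_pos hC, not_le, div_lt_iff₀ hC] at h
    rw [abs_mul]
    calc |bump (t / C)| * |t| ≤ 1 * |t| := by gcongr; exact abs_bump_le _
      _ ≤ 2 * C := by linarith

theorem abs_mul_deriv_bump_le (r : ℝ) : |r * deriv bump r| ≤ 2 * bumpBound := by
  by_cases h : 2 ≤ |r|
  · simp [deriv_bump_eq_zero h, bumpBound_nonneg]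
  · rw [abs_mul]
    exact mul_le_mul (not_le.1 h).le (abs_deriv_bump_le r) (abs_nonneg _) zero_le_two

/-- This bound is why the cutoff in `t` is present: the derivative in `s` of `β(s/R) t` alone is
unbounded in `t`. -/
theorem cutoff_a_bound {R C : ℝ} (hR : 0 < R) (hC : 0 < C) (q : ℝ × ℝ) :
    ‖deriv bump (q.1 / R) / R * (bump (q.2 / C) * q.2)‖ ≤ bumpBound / R * (2 * C) := by
  rw [Real.norm_eq_abs, abs_mul, abs_div, abs_of_pos hR]
  exact mul_le_mul (div_le_div_of_nonneg_right (abs_deriv_bump_le _) hR.le)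
    (abs_bump_div_mul_le hC _) (abs_nonneg _) (div_nonneg bumpBound_nonneg hR.le)

/-- The bound does not depend on `R` and `C`, because `r β'(r)` is bounded. This uniformity allows
dominated convergence as `R → ∞` or `C → 0`. -/
theorem cutoff_b_bound (R C : ℝ) (q : ℝ × ℝ) :
    ‖bump (q.1 / R) * (bump (q.2 / C) + q.2 / C * deriv bump (q.2 / C))‖ ≤ 1 + 2 * bumpBound := by
  rw [norm_mul]
  calc _ ≤ 1 * (1 + 2 * bumpBound) := by
        refine mul_le_mul (abs_bump_le _) ?_ (norm_nonneg _) zero_le_one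
        exact (abs_add_le _ _).trans (add_le_add (abs_bump_le _) (abs_mul_deriv_bump_le _))
    _ = _ := one_mul _

/-- The multiplier `c(s, t) = β(s / R) β(t / C)`, where `β` is the bump function. -/
def cutoff (R C : ℝ) (hR : 0 < R) (hC : 0 < C) : Multiplier where
  c := .ofNormedAddCommGroup (fun q => bump (q.1 / R) * bump (q.2 / C))
    ((bump.continuous.comp (continuous_fst.div_const R)).mul
      (bump.continuous.comp (continuous_snd.div_const C))) 1 fun q => by
        rw [norm_mul]
        exact mul_le_one₀ (abs_bump_le _) (norm_nonneg _) (abs_bump_le _)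
  a := .ofNormedAddCommGroup (fun q => deriv bump (q.1 / R) / R * (bump (q.2 / C) * q.2))
    (((continuous_deriv_bump.comp (continuous_fst.div_const R)).div_const R).mul
      ((bump.continuous.comp (continuous_snd.div_const C)).mul continuous_snd)) _
      (cutoff_a_bound hR hC)
  b := .ofNormedAddCommGroup
    (fun q => bump (q.1 / R) * (bump (q.2 / C) + q.2 / C * deriv bump (q.2 / C)))
    ((bump.continuous.comp (continuous_fst.div_const R)).mul
      ((bump.continuous.comp (continuous_snd.div_const C)).add
      ((continuous_snd.div_const C).mul
        (continuous_deriv_bump.comp (continuous_snd.div_const C))))) _ (cutoff_b_bound R C)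
  smooth := (contDiff_bump.comp (contDiff_fst.div_const R)).mul
    (contDiff_bump.comp (contDiff_snd.div_const C))
  deriv := fun q => by
    have h1 : HasFDerivAt (fun q : ℝ × ℝ => q.1 / R) (R⁻¹ • ContinuousLinearMap.fst ℝ ℝ ℝ) q := by
      simpa [div_eq_inv_mul] using (hasFDerivAt_fst (𝕜 := ℝ) (p := q)).const_mul R⁻¹
    have h2 : HasFDerivAt (fun q : ℝ × ℝ => q.2 / C) (C⁻¹ • ContinuousLinearMap.snd ℝ ℝ ℝ) q := by
      simpa [div_eq_inv_mul] using (hasFDerivAt_snd (𝕜 := ℝ) (p := q)).const_mul C⁻¹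
    have h3 := (hasDerivAt_bump (q.1 / R)).comp_hasFDerivAt q h1
    have h4 := (hasDerivAt_bump (q.2 / C)).comp_hasFDerivAt q h2
    refine ((h3.mul h4).mul hasFDerivAt_snd).congr_fderiv ?_
    ext
    · simp; ring
    · simp; field_simp

theorem cutoff_c (R C : ℝ) (hR : 0 < R) (hC : 0 < C) (q : ℝ × ℝ) :
    (cutoff R C hR hC).c q = bump (q.1 / R) * bump (q.2 / C) := rfl

theorem cutoff_a (R C : ℝ) (hR : 0 < R) (hC : 0 < C) (q : ℝ × ℝ) :
    (cutoff R C hR hC).a q = deriv bump (q.1 / R) / R * (bump (q.2 / C) * q.2) := rfl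

theorem cutoff_b (R C : ℝ) (hR : 0 < R) (hC : 0 < C) (q : ℝ × ℝ) :
    (cutoff R C hR hC).b q = bump (q.1 / R) * (bump (q.2 / C) + q.2 / C * deriv bump (q.2 / C)) :=
  rfl

theorem abs_cutoff_c_le (R C : ℝ) (hR : 0 < R) (hC : 0 < C) (q : ℝ × ℝ) :
    |(cutoff R C hR hC).c q| ≤ 1 := by
  rw [cutoff_c, abs_mul]
  exact mul_le_one₀ (abs_bump_le _) (abs_nonneg _) (abs_bump_le _)

section TwoVariables

variable {e : ℝ}

theorem pinch_c_bound (he : 0 < e) (q : ℝ × ℝ) :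
    ‖2 * q.1 * q.2 / (q.1 ^ 2 + q.2 ^ 2 + e ^ 2)‖ ≤ 1 := by
  have hQ : 0 < q.1 ^ 2 + q.2 ^ 2 + e ^ 2 := by positivity
  rw [Real.norm_eq_abs, abs_div, abs_of_pos hQ, div_le_one hQ, abs_le]
  constructor <;> nlinarith [sq_nonneg (q.1 + q.2), sq_nonneg (q.1 - q.2), sq_nonneg e]

theorem pinch_snd_bound (he : 0 < e) (q : ℝ × ℝ) :
    |q.2 ^ 2 / (q.1 ^ 2 + q.2 ^ 2 + e ^ 2)| ≤ 1 := by
  have hQ : 0 < q.1 ^ 2 + q.2 ^ 2 + e ^ 2 := by positivity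
  rw [abs_of_nonneg (by positivity), div_le_one hQ]
  nlinarith [sq_nonneg q.1, sq_nonneg e]

/-- The partial derivatives are polynomials in the two bounded ratios `2st/Q` and `t²/Q`, where `Q =
s² + t² + e²`. The bounds are therefore uniform in `e`, as needed for the limit `e → 0`. -/
theorem pinch_a_bound (he : 0 < e) (q : ℝ × ℝ) :
    ‖2 * (q.2 ^ 2 / (q.1 ^ 2 + q.2 ^ 2 + e ^ 2)) -
      (2 * q.1 * q.2 / (q.1 ^ 2 + q.2 ^ 2 + e ^ 2)) ^ 2‖ ≤ 3 := by
  have h1 := abs_le.1 (pinch_c_bound he q)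
  have h2 := abs_le.1 (pinch_snd_bound he q)
  rw [Real.norm_eq_abs, abs_le]
  constructor <;> nlinarith

theorem pinch_b_bound (he : 0 < e) (q : ℝ × ℝ) :
    ‖2 * q.1 * q.2 / (q.1 ^ 2 + q.2 ^ 2 + e ^ 2) *
      (2 - 2 * (q.2 ^ 2 / (q.1 ^ 2 + q.2 ^ 2 + e ^ 2)))‖ ≤ 4 := by
  have h1 := pinch_c_bound he q
  have h2 := abs_le.1 (pinch_snd_bound he q)
  rw [norm_mul]
  have h3 : ‖2 - 2 * (q.2 ^ 2 / (q.1 ^ 2 + q.2 ^ 2 + e ^ 2))‖ ≤ 4 := by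
    rw [Real.norm_eq_abs, abs_le]
    constructor <;> linarith
  calc _ ≤ 1 * (4 : ℝ) := mul_le_mul h1 h3 (norm_nonneg _) zero_le_one
    _ = 4 := one_mul _

/-- The multiplier `c(s, t) = 2 s t / (s ^ 2 + t ^ 2 + e ^ 2)`; the function `c(s, t) t` is bounded
by `|t|` and by `2 |s|`. -/
def pinch (e : ℝ) (he : 0 < e) : Multiplier where
  c := .ofNormedAddCommGroup (fun q => 2 * q.1 * q.2 / (q.1 ^ 2 + q.2 ^ 2 + e ^ 2))
    (((continuous_const.mul continuous_fst).mul continuous_snd).div (by fun_prop)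
      fun q => by positivity) _ (pinch_c_bound he)
  a := .ofNormedAddCommGroup (fun q => 2 * (q.2 ^ 2 / (q.1 ^ 2 + q.2 ^ 2 + e ^ 2)) -
      (2 * q.1 * q.2 / (q.1 ^ 2 + q.2 ^ 2 + e ^ 2)) ^ 2)
    (by
      have : ∀ q : ℝ × ℝ, q.1 ^ 2 + q.2 ^ 2 + e ^ 2 ≠ 0 := fun q => by positivity
      fun_prop (disch := assumption)) _ (pinch_a_bound he)
  b := .ofNormedAddCommGroup (fun q => 2 * q.1 * q.2 / (q.1 ^ 2 + q.2 ^ 2 + e ^ 2) *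
      (2 - 2 * (q.2 ^ 2 / (q.1 ^ 2 + q.2 ^ 2 + e ^ 2))))
    (by
      have : ∀ q : ℝ × ℝ, q.1 ^ 2 + q.2 ^ 2 + e ^ 2 ≠ 0 := fun q => by positivity
      fun_prop (disch := assumption)) _ (pinch_b_bound he)
  smooth := ((contDiff_const.mul contDiff_fst).mul contDiff_snd).div
    (((contDiff_fst.pow 2).add (contDiff_snd.pow 2)).add contDiff_const) fun q => by positivity
  deriv := fun q => by
    have hQ : q.1 ^ 2 + q.2 ^ 2 + e ^ 2 ≠ 0 := by positivity
    have h1 : HasFDerivAt (fun q : ℝ × ℝ => q.1) (ContinuousLinearMap.fst ℝ ℝ ℝ) q := hasFDerivAt_fst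
    have h2 : HasFDerivAt (fun q : ℝ × ℝ => q.2) (ContinuousLinearMap.snd ℝ ℝ ℝ) q := hasFDerivAt_snd
    have h3 : HasFDerivAt (fun q : ℝ × ℝ => q.1 ^ 2 + q.2 ^ 2 + e ^ 2) _ q :=
      ((h1.pow 2).add (h2.pow 2)).add_const (e ^ 2)
    have h3 := (hasDerivAt_inv hQ).comp_hasFDerivAt (f := fun q : ℝ × ℝ => q.1 ^ 2 + q.2 ^ 2 + e ^ 2) q h3
    refine ((((h1.const_mul 2).mul h2).mul h3).mul h2).congr_fderiv ?_
    ext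
    · simp; field_simp; try ring
    · simp; field_simp; try ring

theorem pinch_c (he : 0 < e) (q : ℝ × ℝ) :
    (pinch e he).c q = 2 * q.1 * q.2 / (q.1 ^ 2 + q.2 ^ 2 + e ^ 2) := rfl

theorem pinch_a (he : 0 < e) (q : ℝ × ℝ) :
    (pinch e he).a q = 2 * (q.2 ^ 2 / (q.1 ^ 2 + q.2 ^ 2 + e ^ 2)) -
      (2 * q.1 * q.2 / (q.1 ^ 2 + q.2 ^ 2 + e ^ 2)) ^ 2 := rfl

theorem pinch_b (he : 0 < e) (q : ℝ × ℝ) :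
    (pinch e he).b q = 2 * q.1 * q.2 / (q.1 ^ 2 + q.2 ^ 2 + e ^ 2) *
      (2 - 2 * (q.2 ^ 2 / (q.1 ^ 2 + q.2 ^ 2 + e ^ 2))) := rfl

theorem abs_pinch_c_le (he : 0 < e) (q : ℝ × ℝ) : |(pinch e he).c q| ≤ 1 := pinch_c_bound he q

theorem abs_pinch_c_mul_le (he : 0 < e) (q : ℝ × ℝ) :
    |(pinch e he).c q * q.2| ≤ 2 * |q.1| := by
  have h : (pinch e he).c q * q.2 = 2 * q.1 * (q.2 ^ 2 / (q.1 ^ 2 + q.2 ^ 2 + e ^ 2)) := by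
    rw [pinch_c]; ring
  rw [h, abs_mul, abs_mul, abs_two]
  calc _ ≤ 2 * |q.1| * 1 := by gcongr; exact pinch_snd_bound he q
    _ = _ := mul_one _

end TwoVariables

/-! ### Weak gradients and their vanishing on level sets -/

section

variable {N : ℕ} {Ω : Set (EuclideanSpace ℝ (Fin N))} {p : ℝ≥0∞} [Fact (1 ≤ p)]

theorem inner_gradient_right {φ : EuclideanSpace ℝ (Fin N) → ℝ} (e x : EuclideanSpace ℝ (Fin N)) :
    inner ℝ e (∇ φ x) = fderiv ℝ φ x e := by
  rw [real_inner_comm, gradient, InnerProductSpace.toDual_symm_apply]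

theorem continuous_gradient {φ : EuclideanSpace ℝ (Fin N) → ℝ} (hφ : ContDiff ℝ ∞ φ) :
    Continuous (∇ φ) :=
  (InnerProductSpace.toDual ℝ _).symm.continuous.comp (hφ.continuous_fderiv (by simp))

theorem hasCompactSupport_gradient {φ : EuclideanSpace ℝ (Fin N) → ℝ} (hφ : HasCompactSupport φ) :
    HasCompactSupport (∇ φ) :=
  (hφ.fderiv (𝕜 := ℝ)).comp_left (g := (InnerProductSpace.toDual ℝ _).symm) (map_zero _)

theorem gradient_eq_zero_of_notMem_tsupport {φ : EuclideanSpace ℝ (Fin N) → ℝ}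
    {x : EuclideanSpace ℝ (Fin N)} (hx : x ∉ tsupport φ) : ∇ φ x = 0 := by
  have : fderiv ℝ φ x = 0 := by
    by_contra h
    exact hx (support_fderiv_subset ℝ h)
  simp [gradient, this]

theorem integral_smul_gradient_add {φ ψ : EuclideanSpace ℝ (Fin N) → ℝ} (hφ : IsTest Ω φ)
    (hψ : ContDiff ℝ ∞ ψ) (hψc : HasCompactSupport ψ) :
    (∫ x in Ω, φ x • ∇ ψ x) + ∫ x in Ω, ψ x • ∇ φ x = 0 := by
  have i1 : Integrable (fun x => φ x • ∇ ψ x) :=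
    (hφ.smooth.continuous.smul (continuous_gradient hψ)).integrable_of_hasCompactSupport
      hφ.compact.smul_right
  have i2 : Integrable (fun x => ψ x • ∇ φ x) :=
    (hψ.continuous.smul (continuous_gradient hφ.smooth)).integrable_of_hasCompactSupport
      hψc.smul_right
  rw [setIntegral_eq_integral_of_forall_compl_eq_zero, setIntegral_eq_integral_of_forall_compl_eq_zero]
  · refine ext_inner_left ℝ fun e => ?_
    rw [inner_add_right, inner_zero_right, ← integral_inner i1, ← integral_inner i2]
    simp only [inner_smul_right, inner_gradient_right]
    rw [integral_mul_fderiv_eq_neg_fderiv_mul_of_integrable]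
    · simp only [mul_comm (ψ _)]
      exact neg_add_cancel _
    · refine (i2.const_inner e).congr (Eventually.of_forall fun x => ?_)
      simp only [inner_smul_right, inner_gradient_right, mul_comm]
    · refine (i1.const_inner e).congr (Eventually.of_forall fun x => ?_)
      simp only [inner_smul_right, inner_gradient_right]
    · exact (hφ.smooth.continuous.mul hψ.continuous).integrable_of_hasCompactSupport
        hφ.compact.mul_right
    · exact fun x _ => hφ.smooth.differentiable (by simp) x
    · exact fun x _ => hψ.differentiable (by simp) x
  · intro x hx
    rw [gradient_eq_zero_of_notMem_tsupport fun h => hx (hφ.supp h), smul_zero]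
  · intro x hx
    rw [image_eq_zero_of_notMem_tsupport fun h => hx (hφ.supp h), zero_smul]

/-- By Hölder's inequality the left side is continuous in the pair `(w, ∇w)`, and it vanishes on
test pairs. No support condition relative to `Ω` is imposed on `ψ`, since the test function
approximating `w` already has compact support in `Ω`. -/
theorem integral_smul_grad_add (w : W0 Ω p) {ψ : EuclideanSpace ℝ (Fin N) → ℝ}
    (hψ : ContDiff ℝ ∞ ψ) (hψc : HasCompactSupport ψ) :
    (∫ x in Ω, fn w x • ∇ ψ x) + ∫ x in Ω, ψ x • grad w x = 0 := by
  have := ENNReal.HolderConjugate.inv_one_sub_inv' (Fact.out : 1 ≤ p)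
  have : Fact (1 ≤ (1 - p⁻¹)⁻¹) := ⟨ENNReal.one_le_inv.2 tsub_le_self⟩
  have m1 : MemLp (∇ ψ) (1 - p⁻¹)⁻¹ (volume.restrict Ω) :=
    ((continuous_gradient hψ).memLp_of_hasCompactSupport (hasCompactSupport_gradient hψc)).restrict Ω
  have m2 : MemLp ψ (1 - p⁻¹)⁻¹ (volume.restrict Ω) :=
    (hψ.continuous.memLp_of_hasCompactSupport hψc).restrict Ω
  let B₁ : ℝ →L[ℝ] EuclideanSpace ℝ (Fin N) →L[ℝ] EuclideanSpace ℝ (Fin N) :=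
    ContinuousLinearMap.lsmul ℝ ℝ
  let J : LpPair Ω p → EuclideanSpace ℝ (Fin N) := fun w =>
    B₁.lpPairing (volume.restrict Ω) p (1 - p⁻¹)⁻¹ w.fst (m1.toLp _) +
      B₁.flip.lpPairing (volume.restrict Ω) p (1 - p⁻¹)⁻¹ w.snd (m2.toLp _)
  have hJ : ∀ w : LpPair Ω p, J w = (∫ x in Ω, w.fst x • ∇ ψ x) + ∫ x in Ω, ψ x • w.snd x := by
    intro w
    simp only [J, ContinuousLinearMap.lpPairing_eq_integral]
    congr 1
    · refine integral_congr_ae ?_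
      filter_upwards [m1.coeFn_toLp] with x hx
      rw [hx]
      rfl
    · refine integral_congr_ae ?_
      filter_upwards [m2.coeFn_toLp] with x hx
      rw [hx]
      rfl
  have hc : Continuous J := by
    have f1 : Continuous fun w : LpPair Ω p => w.fst := WithLp.continuous_fst p _ _
    have g1 : Continuous fun w : LpPair Ω p => w.snd := WithLp.continuous_snd p _ _
    exact (((ContinuousLinearMap.continuous _).comp f1).clm_apply continuous_const).add
      (((ContinuousLinearMap.continuous _).comp g1).clm_apply continuous_const)
  have h0 : ∀ w ∈ testPairs Ω p, J w = 0 := by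
    rintro w ⟨φ, hφ, ha, hb⟩
    rw [hJ, ← integral_smul_gradient_add hφ hψ hψc]
    congr 1
    · refine integral_congr_ae ?_
      filter_upwards [ha] with x hx
      rw [hx]
    · refine integral_congr_ae ?_
      filter_upwards [hb] with x hx
      rw [hx]
  have h1 : J w = 0 :=
    closure_minimal (s := (testPairs Ω p : Set (LpPair Ω p))) (t := {w | J w = 0}) h0
      (isClosed_eq hc continuous_const) w.2
  rw [hJ] at h1
  exact h1

theorem grad_ae_eq_zero_of_fn_ae_eq_zero {w : W0 Ω p} (h : fn w =ᵐ[volume.restrict Ω] 0) :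
    grad w =ᵐ[volume.restrict Ω] 0 := by
  refine ae_eq_zero_of_integral_contDiff_smul_eq_zero
    ((memLp_grad w).locallyIntegrable Fact.out) fun ψ hψ hψc => ?_
  have := integral_smul_grad_add w hψ hψc
  rwa [integral_congr_ae (g := fun _ => 0) (by filter_upwards [h] with x hx; simp [hx]),
    integral_zero, zero_add] at this

/-- The functions `β((n+1)v) v` tend to `0`, while their gradients tend to the restriction of `∇v`
to `{v = 0}`. This restriction is thus the weak gradient of the zero function. -/
theorem grad_ae_eq_zero_of_fn_eq_zero (hp : p ≠ ⊤) (v : W0 Ω p) :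
    ∀ᵐ x ∂volume.restrict Ω, fn v x = 0 → grad v x = 0 := by
  classical
  let M : ℕ → Multiplier := fun n => cutoff 1 (1 / ((n : ℝ) + 1)) one_pos (by positivity)
  have hd : ∀ n : ℕ, ∀ t : ℝ, t / (1 / ((n : ℝ) + 1)) = (n + 1) * t := fun n t => by
    rw [div_div_eq_mul_div, div_one, mul_comm]
  have hlarge : ∀ t : ℝ, t ≠ 0 → ∀ᶠ n : ℕ in atTop, 2 ≤ |((n : ℝ) + 1) * t| := by
    intro t ht
    have : Tendsto (fun n : ℕ => ((n : ℝ) + 1) * |t|) atTop atTop :=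
      (tendsto_atTop_add_const_right _ _ tendsto_natCast_atTop_atTop).atTop_mul_const
        (abs_pos.2 ht)
    filter_upwards [this.eventually_ge_atTop 2] with n hn
    rwa [abs_mul, abs_of_nonneg (by positivity)]
  -- With first argument `0`, the factor in `s` is `1` and the term with `a` drops out.
  obtain ⟨z, h1, h2, -⟩ := Multiplier.exists_tendsto_app hp M 0 v (K := 1 + 2 * bumpBound)
    (g := fun _ => 0) (G := fun x => if fn v x = 0 then grad v x else 0)
    (fun n q => (abs_cutoff_c_le _ _ _ _ q).trans (by linarith [bumpBound_nonneg]))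
    (fun n => by
      filter_upwards [grad_zero (Ω := Ω) (p := p)] with x hx
      rw [hx, smul_zero, zero_add, norm_zero, zero_add, norm_smul]
      exact mul_le_mul_of_nonneg_right (cutoff_b_bound 1 _ _) (norm_nonneg _))
    (by
      refine Eventually.of_forall fun x => ?_
      by_cases hx : fn v x = 0
      · simp [hx]
      · refine tendsto_const_nhds.congr' ?_
        filter_upwards [hlarge _ hx] with n hn
        rw [cutoff_c, hd, bump_eq_zero hn, mul_zero, zero_mul])
    (by
      filter_upwards [grad_zero (Ω := Ω) (p := p), fn_zero (Ω := Ω) (p := p)] with x hx hx0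
      simp only [hx, hx0, smul_zero, zero_add]
      by_cases hv : fn v x = 0
      · simp [hv, M, cutoff_b, bump_eq_one]
      · refine tendsto_const_nhds.congr' ?_
        filter_upwards [hlarge _ hv] with n hn
        rw [cutoff_b, hd, bump_eq_zero hn, deriv_bump_eq_zero hn]
        simp [hv])
  filter_upwards [h2, grad_ae_eq_zero_of_fn_ae_eq_zero h1] with x hx hx' hv
  rw [hx'] at hx
  simpa [hv] using hx.symm

end

/-! ### Integrals with values in `[-∞, ∞]` -/

theorem lintegral_ofReal_lt_top_of_integrable {α : Type*} [MeasurableSpace α] {μ : Measure α} {k : α → ℝ}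
    (hk : Integrable k μ) : ∫⁻ x, ENNReal.ofReal (k x) ∂μ < ⊤ :=
  (lintegral_mono fun x => Real.ofReal_le_enorm (k x)).trans_lt hk.2

/-- An integrable perturbation cannot change which of the two parts has infinite integral, so the
convention for `∞ - ∞` is respected. -/
theorem extIntegral_add {α : Type*} [MeasurableSpace α] {μ : Measure α} {g k : α → ℝ}
    (hg : AEMeasurable g μ) (hk : Integrable k μ) :
    extIntegral μ (fun x => g x + k x) = extIntegral μ g + ((∫ x, k x ∂μ : ℝ) : EReal) := by
  have hkm := hk.aemeasurable
  have hgn : AEMeasurable (fun x => ENNReal.ofReal (-g x)) μ := hg.neg.ennreal_ofReal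
  have hkn : AEMeasurable (fun x => ENNReal.ofReal (-k x)) μ := hkm.neg.ennreal_ofReal
  have hgk : AEMeasurable (fun x => g x + k x) μ := hg.add hkm
  have hgkn : AEMeasurable (fun x => ENNReal.ofReal (-(g x + k x))) μ := hgk.neg.ennreal_ofReal
  have ha : ∫⁻ x, ENNReal.ofReal (k x) ∂μ ≠ ⊤ := (lintegral_ofReal_lt_top_of_integrable hk).ne
  have hb : ∫⁻ x, ENNReal.ofReal (-k x) ∂μ ≠ ⊤ := (lintegral_ofReal_lt_top_of_integrable hk.neg).ne
  have hint : ∫ x, k x ∂μ = (∫⁻ x, ENNReal.ofReal (k x) ∂μ).toReal -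
      (∫⁻ x, ENNReal.ofReal (-k x) ∂μ).toReal := integral_eq_lintegral_pos_part_sub_lintegral_neg_part hk
  have le1 : ∫⁻ x, ENNReal.ofReal (g x + k x) ∂μ ≤
      ∫⁻ x, ENNReal.ofReal (g x) ∂μ + ∫⁻ x, ENNReal.ofReal (k x) ∂μ := by
    rw [← lintegral_add_left' hg.ennreal_ofReal]
    exact lintegral_mono fun x => ENNReal.ofReal_add_le
  have le2 : ∫⁻ x, ENNReal.ofReal (g x) ∂μ ≤
      ∫⁻ x, ENNReal.ofReal (g x + k x) ∂μ + ∫⁻ x, ENNReal.ofReal (-k x) ∂μ := by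
    rw [← lintegral_add_left' hgk.ennreal_ofReal]
    refine lintegral_mono fun x => ?_
    simpa using ENNReal.ofReal_add_le (p := g x + k x) (q := -k x)
  -- The identity `(g+k)⁺ + g⁻ + k⁻ = (g+k)⁻ + g⁺ + k⁺`, free of subtractions, can be integrated in
  -- `[0, ∞]`.
  have id1 : ∫⁻ x, ENNReal.ofReal (g x + k x) ∂μ + ∫⁻ x, ENNReal.ofReal (-g x) ∂μ +
      ∫⁻ x, ENNReal.ofReal (-k x) ∂μ = ∫⁻ x, ENNReal.ofReal (-(g x + k x)) ∂μ +
      ∫⁻ x, ENNReal.ofReal (g x) ∂μ + ∫⁻ x, ENNReal.ofReal (k x) ∂μ := by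
    rw [← lintegral_add_left' hgk.ennreal_ofReal, ← lintegral_add_left' hgkn,
      ← lintegral_add_right' _ hkn, ← lintegral_add_right' _ hkm.ennreal_ofReal]
    refine lintegral_congr fun x => ?_
    have e : ∀ r : ℝ, ENNReal.ofReal r = ENNReal.ofReal (max r 0) := fun r => by
      rcases le_total r 0 with h | h <;> simp [h, ENNReal.ofReal_of_nonpos]
    rw [e (g x + k x), e (-g x), e (-k x), e (-(g x + k x)), e (g x), e (k x)]
    rw [← ENNReal.ofReal_add (le_max_right _ _) (le_max_right _ _),
      ← ENNReal.ofReal_add (by positivity) (le_max_right _ _),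
      ← ENNReal.ofReal_add (le_max_right _ _) (le_max_right _ _),
      ← ENNReal.ofReal_add (by positivity) (le_max_right _ _)]
    congr 1
    rcases le_total (g x) 0 with h1 | h1 <;> rcases le_total (k x) 0 with h2 | h2 <;>
      rcases le_total (g x + k x) 0 with h3 | h3 <;> simp [h1, h2] <;> grind
  rw [extIntegral, extIntegral, hint]
  generalize ∫⁻ x, ENNReal.ofReal (g x) ∂μ = P at *
  generalize ∫⁻ x, ENNReal.ofReal (g x + k x) ∂μ = P' at *
  generalize ∫⁻ x, ENNReal.ofReal (-g x) ∂μ = Q at *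
  generalize ∫⁻ x, ENNReal.ofReal (-(g x + k x)) ∂μ = Q' at *
  generalize ∫⁻ x, ENNReal.ofReal (k x) ∂μ = a at *
  generalize ∫⁻ x, ENNReal.ofReal (-k x) ∂μ = b at *
  by_cases hP : P = ⊤
  · have hP' : P' = ⊤ := by
      by_contra h
      rw [hP, top_le_iff] at le2
      exact ENNReal.add_ne_top.2 ⟨h, hb⟩ le2
    rw [if_pos hP, if_pos hP', EReal.top_add_coe]
  · have hP' : P' ≠ ⊤ := ne_top_of_le_ne_top (ENNReal.add_ne_top.2 ⟨hP, ha⟩) le1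
    rw [if_neg hP, if_neg hP']
    lift P to NNReal using hP
    lift P' to NNReal using hP'
    lift a to NNReal using ha
    lift b to NNReal using hb
    by_cases hQ : Q = ⊤
    · subst hQ
      have : Q' = ⊤ := by
        by_contra h
        lift Q' to NNReal using h
        simp only [add_top, top_add] at id1
        exact absurd id1.symm (by finiteness)
      subst this
      simp only [EReal.coe_ennreal_top, EReal.sub_top, EReal.bot_add]
    · lift Q to NNReal using hQ
      have : Q' ≠ ⊤ := by
        rintro rfl
        simp at id1
      lift Q' to NNReal using this
      have id2 : (P' : ℝ) + Q + b = Q' + P + a := by exact_mod_cast id1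
      simp only [ENNReal.coe_toReal]
      have c : ∀ r : NNReal, (((r : ℝ≥0∞)) : EReal) = ((r : ℝ) : EReal) := fun r => rfl
      rw [c, c, c, c, ← EReal.coe_sub, ← EReal.coe_sub, ← EReal.coe_add]
      congr 1
      linarith

/-! ### Increments of the primitive -/

section Average

/-- The mean value of `f(x, ·)` on the segment from `a` to `a + b`. -/
def segAvg {X : Type*} (f : X → ℝ → ℝ) (x : X) (a b : ℝ) : ℝ := ∫ r in (0 : ℝ)..1, f x (a + r * b)

variable {X : Type*} {f : X → ℝ → ℝ} {x : X}

theorem segAvg_zero (a : ℝ) : segAvg f x a 0 = f x a := by simp [segAvg]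

/-- The difference quotient of the primitive is written as a mean value, which remains meaningful
and continuous at `b = 0`. -/
theorem primitive_add_sub (hf : Continuous (f x)) (a b : ℝ) :
    primitive f x (a + b) - primitive f x a = b * segAvg f x a b := by
  rw [primitive, primitive,
    intervalIntegral.integral_interval_sub_left (hf.intervalIntegrable _ _)
      (hf.intervalIntegrable _ _), segAvg]
  have := intervalIntegral.mul_integral_comp_add_mul (f := f x) (a := 0) (b := 1) (c := b) (d := a)
  simp only [mul_zero, add_zero, mul_one] at this
  rw [← this]
  simp only [mul_comm b]

theorem continuous_segAvg (hf : Continuous (f x)) :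
    Continuous fun q : ℝ × ℝ => segAvg f x q.1 q.2 := by
  unfold segAvg
  refine intervalIntegral.continuous_parametric_intervalIntegral_of_continuous'
    (f := fun (q : ℝ × ℝ) r => f x (q.1 + r * q.2)) ?_ 0 1
  simp only [Function.uncurry_def]
  fun_prop

theorem abs_segAvg_le {R M : ℝ} (hM : ∀ s, |s| ≤ R → |f x s| ≤ M) {a b : ℝ} (ha : |a| ≤ R)
    (hb : |a + b| ≤ R) : |segAvg f x a b| ≤ M := by
  have := intervalIntegral.norm_integral_le_of_norm_le_const (f := fun r => f x (a + r * b))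
    (a := 0) (b := 1) (C := M) fun r hr => by
      refine hM _ ?_
      rw [uIoc_of_le zero_le_one] at hr
      have h1 := abs_le.1 ha
      have h2 := abs_le.1 hb
      rw [abs_le]
      constructor <;> nlinarith [hr.1, hr.2]
  simpa [segAvg] using this

end Average

/-! ### Measurability and local bounds for Carathéodory functions -/

section Caratheodory

variable {N : ℕ} {Ω : Set (EuclideanSpace ℝ (Fin N))} {f : EuclideanSpace ℝ (Fin N) → ℝ → ℝ}

/-- Outside one null set, `f x` is continuous and agrees at all rational `s` with measurable
representatives. Continuity then carries measurability to real `s`, and to both variables jointly.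
-/
theorem IsCaratheodory.exists_measurable (hf : IsCaratheodory Ω f) :
    ∃ g : EuclideanSpace ℝ (Fin N) → ℝ → ℝ, Measurable (Function.uncurry g) ∧
      (∀ x, Continuous (g x)) ∧ ∀ᵐ x ∂volume.restrict Ω, f x = g x := by
  classical
  have hae : ∀ᵐ x ∂volume.restrict Ω, Continuous (f x) ∧
      ∀ q : ℚ, f x q = (hf.1 q).mk _ x :=
    hf.2.and (ae_all_iff.2 fun q => (hf.1 q).ae_eq_mk)
  obtain ⟨S, hS, hSm, hS'⟩ := hae.exists_measurable_mem
  let g : EuclideanSpace ℝ (Fin N) → ℝ → ℝ := fun x s => if x ∈ S then f x s else 0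
  have hgc : ∀ x, Continuous (g x) := by
    intro x
    by_cases hx : x ∈ S
    · simpa [g, hx] using (hS' x hx).1
    · simpa [g, hx] using continuous_const
  have hgq : ∀ q : ℚ, Measurable fun x => g x q := by
    intro q
    have h : (fun x => g x q) = S.indicator ((hf.1 q).mk _) := by
      funext x
      by_cases hx : x ∈ S
      · simp only [g, hx, if_true, indicator_of_mem, (hS' x hx).2 q]
      · simp only [g, hx, if_false, not_false_eq_true, indicator_of_notMem]
    rw [h]
    exact (hf.1 q).measurable_mk.indicator hSm
  have hgm : ∀ s, Measurable fun x => g x s := by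
    intro s
    obtain ⟨u, hu, hul⟩ := mem_closure_iff_seq_limit.1 (Rat.denseRange_cast (𝕜 := ℝ) s)
    choose q hq using hu
    refine measurable_of_tendsto_metrizable (f := fun n x => g x (q n)) (fun n => hgq (q n)) ?_
    rw [tendsto_pi_nhds]
    intro x
    refine ((hgc x).tendsto s).comp ?_
    simpa only [hq] using hul
  refine ⟨g, ?_, hgc, ?_⟩
  · have := measurable_uncurry_of_continuous_of_measurable (u := fun s x => g x s) hgc hgm
    exact this.comp measurable_swap
  · filter_upwards [hS] with x hx
    funext s
    simp [g, hx]

theorem IsCaratheodory.aemeasurable_segAvg (hf : IsCaratheodory Ω f)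
    {u v : EuclideanSpace ℝ (Fin N) → ℝ} (hu : AEMeasurable u (volume.restrict Ω))
    (hv : AEMeasurable v (volume.restrict Ω)) :
    AEMeasurable (fun x => segAvg f x (u x) (v x)) (volume.restrict Ω) := by
  obtain ⟨g, hgm, -, hg⟩ := hf.exists_measurable
  have h1 : AEMeasurable (fun x => segAvg g x (hu.mk u x) (hv.mk v x)) (volume.restrict Ω) := by
    refine Measurable.aemeasurable ?_
    simp only [segAvg, intervalIntegral.integral_of_le zero_le_one]
    refine StronglyMeasurable.measurable ?_
    refine StronglyMeasurable.integral_prod_right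
      (f := fun x r => g x (hu.mk u x + r * hv.mk v x)) ?_
    refine Measurable.stronglyMeasurable ?_
    exact hgm.comp (measurable_fst.prodMk
      ((hu.measurable_mk.comp measurable_fst).add
        (measurable_snd.mul (hv.measurable_mk.comp measurable_fst))))
  refine h1.congr ?_
  filter_upwards [hg, hu.ae_eq_mk, hv.ae_eq_mk] with x h1 h2 h3
  rw [segAvg, segAvg, h1, h2, h3]

theorem IsCaratheodory.aemeasurable_comp (hf : IsCaratheodory Ω f)
    {u : EuclideanSpace ℝ (Fin N) → ℝ} (hu : AEMeasurable u (volume.restrict Ω)) :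
    AEMeasurable (fun x => f x (u x)) (volume.restrict Ω) := by
  refine (hf.aemeasurable_segAvg hu (aemeasurable_const (b := (0 : ℝ)))).congr ?_
  exact Eventually.of_forall fun x => segAvg_zero _

theorem IsCaratheodory.aemeasurable_primitive (hf : IsCaratheodory Ω f)
    {u : EuclideanSpace ℝ (Fin N) → ℝ} (hu : AEMeasurable u (volume.restrict Ω)) :
    AEMeasurable (fun x => primitive f x (u x)) (volume.restrict Ω) := by
  refine (hu.mul (hf.aemeasurable_segAvg (aemeasurable_const (b := (0 : ℝ))) hu)).congr ?_
  filter_upwards [hf.2] with x hx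
  have := primitive_add_sub hx 0 (u x)
  simp only [zero_add] at this
  simp only [Pi.mul_apply, ← this]
  simp [primitive]

theorem LocalSupIntegrable.exists_bound (hf : IsCaratheodory Ω f) (hf₀ : LocalSupIntegrable Ω f)
    {R : ℝ} (hR : 0 < R) {K : Set (EuclideanSpace ℝ (Fin N))} (hK : IsCompact K) (hKΩ : K ⊆ Ω) :
    ∃ S : EuclideanSpace ℝ (Fin N) → ℝ, IntegrableOn S K volume ∧ (∀ x, 0 ≤ S x) ∧
      ∀ᵐ x ∂volume.restrict Ω, ∀ s, |s| ≤ R → |f x s| ≤ S x := by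
  refine ⟨fun x => ⨆ s : Icc (-R) R, |f x s|, (hf₀ R hR).integrableOn_compact_subset hKΩ hK,
    fun x => Real.iSup_nonneg fun s => abs_nonneg _, ?_⟩
  filter_upwards [hf.2] with x hx s hs
  have hb : BddAbove (range fun s : Icc (-R) R => |f x s|) := by
    have := (isCompact_Icc (a := -R) (b := R)).bddAbove_image (hx.abs).continuousOn
    rwa [image_eq_range] at this
  exact le_ciSup hb (⟨s, abs_le.1 hs⟩ : Icc (-R) R)

end Caratheodory

/-! ### Pointwise inequalities for the power of the norm -/

section Pointwise

variable {V : Type*} [NormedAddCommGroup V] [InnerProductSpace ℝ V] {r : ℝ}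

omit [InnerProductSpace ℝ V] in
theorem rpow_sub_two_mul_norm (hr : 1 < r) (c : V) : ‖c‖ ^ (r - 2) * ‖c‖ ≤ ‖c‖ ^ (r - 1) := by
  rcases (norm_nonneg c).eq_or_lt' with h | h
  · rw [h, mul_zero, Real.zero_rpow (by linarith)]
  · rw [← Real.rpow_add_one h.ne']
    exact le_of_eq (by ring_nf)

theorem abs_rpow_mul_inner_le (hr : 1 < r) (c b : V) :
    |‖c‖ ^ (r - 2) * inner ℝ c b| ≤ ‖c‖ ^ (r - 1) * ‖b‖ := by
  rw [abs_mul, abs_of_nonneg (by positivity)]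
  calc ‖c‖ ^ (r - 2) * |inner ℝ c b| ≤ ‖c‖ ^ (r - 2) * (‖c‖ * ‖b‖) := by
        gcongr
        exact abs_real_inner_le_norm c b
    _ = ‖c‖ ^ (r - 2) * ‖c‖ * ‖b‖ := by ring
    _ ≤ _ := by gcongr; exact rpow_sub_two_mul_norm hr c

theorem rpow_sub_one_mul_self (hr : 1 < r) {x : ℝ} (hx : 0 ≤ x) : x ^ (r - 1) * x = x ^ r := by
  rcases hx.eq_or_lt' with h | h
  · rw [h, mul_zero, Real.zero_rpow (by linarith)]
  · rw [← Real.rpow_add_one h.ne', sub_add_cancel]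

theorem rpow_sub_one_mul_le (hr : 1 < r) {x y m : ℝ} (hx : 0 ≤ x) (hy : 0 ≤ y) (hxm : x ≤ m)
    (hym : y ≤ m) : x ^ (r - 1) * y ≤ m ^ r := by
  rw [← rpow_sub_one_mul_self hr (hx.trans hxm)]
  exact mul_le_mul (Real.rpow_le_rpow hx hxm (by linarith)) hym hy
    (Real.rpow_nonneg (hx.trans hxm) _)

/-- The only delicate point is `c = 0`, where the weight is singular if `r < 2`; there the product
is at most `‖c‖ ^ (r - 1) ‖b‖`. -/
theorem continuous_rpow_mul_inner (hr : 1 < r) (b : V) :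
    Continuous fun c : V => ‖c‖ ^ (r - 2) * inner ℝ c b := by
  rw [continuous_iff_continuousAt]
  intro c
  by_cases hc : c = 0
  · subst hc
    rw [ContinuousAt, inner_zero_left, mul_zero]
    refine squeeze_zero_norm (fun c => abs_rpow_mul_inner_le hr c b) ?_
    have : Continuous fun c : V => ‖c‖ ^ (r - 1) * ‖b‖ :=
      (continuous_norm.rpow_const fun _ => Or.inr (by linarith)).mul continuous_const
    simpa [Real.zero_rpow (by linarith : r - 1 ≠ 0)] using this.tendsto 0
  · exact (continuous_norm.continuousAt.rpow_const (Or.inl (norm_ne_zero_iff.2 hc))).mul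
      (continuous_id.inner continuous_const).continuousAt

/-- The tangent inequality at `c` for the convex function `‖·‖ ^ r / r`, obtained from
Cauchy–Schwarz and Young's inequality. -/
theorem rpow_norm_sub_le (hr : 1 < r) (c a : V) :
    1 / r * (‖c‖ ^ r - ‖a‖ ^ r) ≤ ‖c‖ ^ (r - 2) * inner ℝ c (c - a) := by
  have hr0 : 0 < r := by linarith
  have h1 : ‖c‖ ^ (r - 2) * inner ℝ c c = ‖c‖ ^ r := by
    rw [real_inner_self_eq_norm_sq]
    rcases (norm_nonneg c).eq_or_lt' with h | h
    · rw [h, Real.zero_rpow hr0.ne']; ring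
    · rw [← Real.rpow_natCast, ← Real.rpow_add h]
      norm_num
  have h2 := (le_abs_self _).trans (abs_rpow_mul_inner_le hr c a)
  have h3 := Real.young_inequality_of_nonneg (norm_nonneg a)
    (Real.rpow_nonneg (norm_nonneg c) (r - 1)) (Real.HolderConjugate.conjExponent hr)
  have h4 : (‖c‖ ^ (r - 1)) ^ r.conjExponent = ‖c‖ ^ r := by
    rw [← Real.rpow_mul (norm_nonneg c), Real.conjExponent]
    congr 1
    field_simp [(by linarith : r - 1 ≠ 0)]
  have h5 : ‖c‖ ^ r / r.conjExponent = ‖c‖ ^ r - ‖c‖ ^ r / r := by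
    rw [Real.conjExponent]
    field_simp [(by linarith : r - 1 ≠ 0)]
  rw [h4, h5] at h3
  rw [inner_sub_right, mul_sub (‖c‖ ^ (r - 2)), h1]
  have h6 : 1 / r * (‖c‖ ^ r - ‖a‖ ^ r) = ‖c‖ ^ r / r - ‖a‖ ^ r / r := by ring
  rw [h6]
  linarith

end Pointwise

/-- Convexity: `a + t b` is the convex combination of `a` and `a + s b` with weight `t / s` on the
latter. -/
theorem norm_rpow_slope_mono {V : Type*} [NormedAddCommGroup V] [NormedSpace ℝ V] {r : ℝ}
    (hr : 1 < r) (a b : V) {s t : ℝ} (ht : 0 ≤ t) (hts : t ≤ s) (hs : 0 < s) :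
    ‖a + t • b‖ ^ r - ‖a‖ ^ r ≤ t * ((‖a + s • b‖ ^ r - ‖a‖ ^ r) / s) := by
  have h1 : a + t • b = (1 - t / s) • a + (t / s) • (a + s • b) := by
    simp only [smul_add, smul_smul, sub_smul, one_smul, div_mul_cancel₀ _ hs.ne']
    abel
  have hl : 0 ≤ 1 - t / s := by rw [sub_nonneg]; exact (div_le_one hs).2 hts
  have hl' : 0 ≤ t / s := by positivity
  have h3 : ‖a + t • b‖ ≤ (1 - t / s) * ‖a‖ + t / s * ‖a + s • b‖ := by
    rw [h1]
    refine (norm_add_le _ _).trans ?_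
    rw [norm_smul, norm_smul, Real.norm_of_nonneg hl, Real.norm_of_nonneg hl']
  have h4 : ‖a + t • b‖ ^ r ≤ (1 - t / s) * ‖a‖ ^ r + t / s * ‖a + s • b‖ ^ r := by
    refine (Real.rpow_le_rpow (norm_nonneg _) h3 (by linarith)).trans ?_
    exact (convexOn_rpow hr.le).2 (norm_nonneg _) (norm_nonneg _) hl hl' (sub_add_cancel _ _)
  have h6 : t * ((‖a + s • b‖ ^ r - ‖a‖ ^ r) / s) = t / s * ‖a + s • b‖ ^ r - t / s * ‖a‖ ^ r := by
    ring
  rw [h6]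
  linarith

/-! ### The energy and the `p`-Laplacian -/

section

variable {N : ℕ} {Ω : Set (EuclideanSpace ℝ (Fin N))} {p : ℝ≥0∞} [Fact (1 ≤ p)]

/-- The energy `(1/p) ∫_Ω |∇w|^p dx`. -/
def energy (w : W0 Ω p) : ℝ := 1 / p.toReal * ∫ x in Ω, ‖grad w x‖ ^ p.toReal

theorem integrable_grad_rpow (hp : 1 < p) (hp' : p ≠ ⊤) (w : W0 Ω p) :
    IntegrableOn (fun x => ‖grad w x‖ ^ p.toReal) Ω volume :=
  (memLp_grad w).integrable_norm_rpow (zero_lt_one.trans hp).ne' hp'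

theorem integral_grad_rpow (hp : 1 < p) (hp' : p ≠ ⊤) (w : W0 Ω p) :
    ∫ x in Ω, ‖grad w x‖ ^ p.toReal = ‖gradL w‖ ^ p.toReal := by
  have hp0 : p ≠ 0 := (zero_lt_one.trans hp).ne'
  have hr : 0 < p.toReal := ENNReal.toReal_pos hp0 hp'
  have h0 : 0 ≤ ∫ x in Ω, ‖grad w x‖ ^ p.toReal :=
    integral_nonneg fun x => Real.rpow_nonneg (norm_nonneg _) _
  have h1 : ‖gradL w‖ = (∫ x in Ω, ‖grad w x‖ ^ p.toReal) ^ p.toReal⁻¹ := by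
    rw [Lp.norm_def, (Lp.memLp (gradL w)).eLpNorm_eq_integral_rpow_norm hp0 hp',
      coeFn_gradL, ENNReal.toReal_ofReal (Real.rpow_nonneg h0 _)]
  rw [h1, ← Real.rpow_mul h0, inv_mul_cancel₀ hr.ne', Real.rpow_one]

theorem continuous_energy (hp : 1 < p) (hp' : p ≠ ⊤) : Continuous (energy (Ω := Ω) (p := p)) := by
  unfold energy
  simp only [integral_grad_rpow hp hp']
  exact continuous_const.mul (gradL.continuous.norm.rpow_const fun _ => Or.inr ENNReal.toReal_nonneg)

omit [Fact (1 ≤ p)] in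
theorem one_lt_toReal (hp : 1 < p) (hp' : p ≠ ⊤) : 1 < p.toReal := by
  rw [← ENNReal.toReal_one]
  exact (ENNReal.toReal_lt_toReal ENNReal.one_ne_top hp').2 hp

theorem energy_eq (hp : 1 < p) (hp' : p ≠ ⊤) (w : W0 Ω p) :
    energy w = 1 / p.toReal * ‖gradL w‖ ^ p.toReal := by
  rw [energy, integral_grad_rpow hp hp']

theorem energy_eq_add (hp : 1 < p) (hp' : p ≠ ⊤) (w z : W0 Ω p) (t : ℝ) :
    energy (w + t • z) = 1 / p.toReal * ‖gradL w + t • gradL z‖ ^ p.toReal := by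
  rw [energy_eq hp hp', gradL_add_smul]

-- The energy is a power of the `L^p` norm of the gradient, so the convexity inequality can be
-- applied directly in `L^p`. The slope at a fixed `s` then serves for all `t ≤ s`.
set_option maxHeartbeats 1000000 in
theorem energy_slope_mono (hp : 1 < p) (hp' : p ≠ ⊤) (w z : W0 Ω p) {s t : ℝ} (ht : 0 ≤ t)
    (hts : t ≤ s) (hs : 0 < s) :
    energy (w + t • z) - energy w ≤ t * ((energy (w + s • z) - energy w) / s) := by
  have hr := one_lt_toReal hp hp'
  have h := norm_rpow_slope_mono hr (gradL w) (gradL z) ht hts hs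
  rw [energy_eq_add hp hp', energy_eq_add hp hp', energy_eq hp hp']
  generalize ‖gradL w + t • gradL z‖ ^ p.toReal = A at *
  generalize ‖gradL w + s • gradL z‖ ^ p.toReal = B at *
  generalize ‖gradL w‖ ^ p.toReal = C at *
  rw [← mul_sub, ← mul_sub, mul_div_assoc, mul_left_comm]
  exact mul_le_mul_of_nonneg_left h (by positivity)

theorem aestronglyMeasurable_rpow_mul_inner {G H : EuclideanSpace ℝ (Fin N) →
    EuclideanSpace ℝ (Fin N)} (r : ℝ) (hG : AEStronglyMeasurable G (volume.restrict Ω))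
    (hH : AEStronglyMeasurable H (volume.restrict Ω)) :
    AEStronglyMeasurable (fun x => ‖G x‖ ^ (r - 2) * inner ℝ (G x) (H x))
      (volume.restrict Ω) :=
  ((hG.norm.aemeasurable.pow_const _).mul (hG.inner hH).aemeasurable).aestronglyMeasurable

theorem integrable_sum_rpow (hp : 1 < p) (hp' : p ≠ ⊤) (u v : W0 Ω p) :
    IntegrableOn (fun x => (‖grad u x‖ + ‖grad v x‖) ^ p.toReal) Ω volume := by
  refine (((memLp_grad u).norm.add (memLp_grad v).norm).integrable_norm_rpow
    (zero_lt_one.trans hp).ne' hp').congr (Eventually.of_forall fun x => ?_)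
  simp only [Pi.add_apply]
  rw [Real.norm_of_nonneg (by positivity)]

theorem integrable_pLaplacePairing (hp : 1 < p) (hp' : p ≠ ⊤) (u v : W0 Ω p) :
    IntegrableOn (fun x => ‖grad u x‖ ^ (p.toReal - 2) * inner ℝ (grad u x) (grad v x)) Ω
      volume := by
  refine (integrable_sum_rpow hp hp' u v).mono'
    (aestronglyMeasurable_rpow_mul_inner _ (memLp_grad u).1 (memLp_grad v).1)
    (Eventually.of_forall fun x => ?_)
  refine (abs_rpow_mul_inner_le (one_lt_toReal hp hp') _ _).trans ?_
  exact rpow_sub_one_mul_le (one_lt_toReal hp hp') (norm_nonneg _) (norm_nonneg _)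
    (le_add_of_nonneg_right (norm_nonneg _)) (le_add_of_nonneg_left (norm_nonneg _))

/-- By the tangent inequality the slope is at most the derivative of the energy at `u + s v` along
`v`, which tends to the pairing at `u` as `s → 0` by dominated convergence. -/
theorem exists_energy_slope_lt (hp : 1 < p) (hp' : p ≠ ⊤) (u v : W0 Ω p) {ε : ℝ} (hε : 0 < ε) :
    ∃ s : ℝ, 0 < s ∧ (energy (u + s • v) - energy u) / s < pLaplacePairing u v + ε := by
  have hr := one_lt_toReal hp hp'
  let I : ℝ → ℝ := fun s => ∫ x in Ω, ‖grad u x + s • grad v x‖ ^ (p.toReal - 2) *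
    inner ℝ (grad u x + s • grad v x) (grad v x)
  have hm : ∀ s : ℝ, AEStronglyMeasurable (fun x => ‖grad u x + s • grad v x‖ ^ (p.toReal - 2) *
      inner ℝ (grad u x + s • grad v x) (grad v x)) (volume.restrict Ω) := fun s =>
    aestronglyMeasurable_rpow_mul_inner _ ((memLp_grad u).1.add ((memLp_grad v).1.const_smul s))
      (memLp_grad v).1
  have hb : ∀ s ∈ Ioo (0 : ℝ) 1, ∀ x, ‖‖grad u x + s • grad v x‖ ^ (p.toReal - 2) *
      inner ℝ (grad u x + s • grad v x) (grad v x)‖ ≤ (‖grad u x‖ + ‖grad v x‖) ^ p.toReal := by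
    intro s hs x
    refine (abs_rpow_mul_inner_le hr _ _).trans ?_
    refine rpow_sub_one_mul_le hr (norm_nonneg _) (norm_nonneg _) ?_
      (le_add_of_nonneg_left (norm_nonneg _))
    refine (norm_add_le _ _).trans (add_le_add_right ?_ _)
    rw [norm_smul, Real.norm_of_nonneg hs.1.le]
    exact mul_le_of_le_one_left (norm_nonneg _) hs.2.le
  have h01 : Ioo (0 : ℝ) 1 ∈ 𝓝[>] (0 : ℝ) := Ioo_mem_nhdsGT one_pos
  have hI : Tendsto I (𝓝[>] 0) (𝓝 (pLaplacePairing u v)) := by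
    refine tendsto_integral_filter_of_dominated_convergence _ (Eventually.of_forall hm) ?_
      (integrable_sum_rpow hp hp' u v) ?_
    · filter_upwards [h01] with s hs
      exact Eventually.of_forall (hb s hs)
    · refine Eventually.of_forall fun x => ?_
      have : Continuous fun s : ℝ => ‖grad u x + s • grad v x‖ ^ (p.toReal - 2) *
          inner ℝ (grad u x + s • grad v x) (grad v x) :=
        (continuous_rpow_mul_inner hr (grad v x)).comp (by fun_prop)
      have h := this.tendsto 0
      simp only [zero_smul, add_zero] at h
      exact h.mono_left nhdsWithin_le_nhds
  have hev := (hI.eventually_lt_const (lt_add_of_pos_right _ hε)).and h01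
  obtain ⟨s, hs, hs1⟩ := hev.exists
  refine ⟨s, hs1.1, lt_of_le_of_lt ?_ hs⟩
  rw [div_le_iff₀ hs1.1, energy, energy, ← mul_sub, ← integral_sub (integrable_grad_rpow hp hp' _)
    (integrable_grad_rpow hp hp' _), ← integral_const_mul, ← integral_mul_const]
  refine integral_mono_ae (((integrable_grad_rpow hp hp' _).sub
    (integrable_grad_rpow hp hp' _)).const_mul _)
    (((integrable_sum_rpow hp hp' u v).mono' (hm s)
      (Eventually.of_forall (hb s hs1))).mul_const s) ?_
  filter_upwards [grad_add u (s • v), grad_smul s v] with x h1 h2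
  rw [h1, h2]
  refine (rpow_norm_sub_le hr _ _).trans (le_of_eq ?_)
  rw [add_sub_cancel_left, inner_smul_right]
  ring

theorem pLaplacePairing_add (hp : 1 < p) (hp' : p ≠ ⊤) (u v w : W0 Ω p) :
    pLaplacePairing u (v + w) = pLaplacePairing u v + pLaplacePairing u w := by
  rw [pLaplacePairing, pLaplacePairing, pLaplacePairing,
    ← integral_add (integrable_pLaplacePairing hp hp' u v) (integrable_pLaplacePairing hp hp' u w)]
  refine integral_congr_ae ?_
  filter_upwards [grad_add v w] with x hx
  rw [hx, inner_add_right, mul_add]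

theorem pLaplacePairing_smul (u : W0 Ω p) (c : ℝ) (v : W0 Ω p) :
    pLaplacePairing u (c • v) = c * pLaplacePairing u v := by
  rw [pLaplacePairing, pLaplacePairing, ← integral_const_mul]
  refine integral_congr_ae ?_
  filter_upwards [grad_smul c v] with x hx
  rw [hx, inner_smul_right]
  ring

/-- A crude bound by the larger of the two gradients suffices: a linear form that is bounded on the
unit ball is continuous. -/
theorem abs_pLaplacePairing_le (hp : 1 < p) (hp' : p ≠ ⊤) (u v : W0 Ω p) :
    |pLaplacePairing u v| ≤ ‖gradL u‖ ^ p.toReal + ‖gradL v‖ ^ p.toReal := by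
  have hr := one_lt_toReal hp hp'
  rw [← integral_grad_rpow hp hp' u, ← integral_grad_rpow hp hp' v,
    ← integral_add (integrable_grad_rpow hp hp' _) (integrable_grad_rpow hp hp' _)]
  rw [← Real.norm_eq_abs, pLaplacePairing]
  refine norm_integral_le_of_norm_le ((integrable_grad_rpow hp hp' _).add
    (integrable_grad_rpow hp hp' _)) (Eventually.of_forall fun x => ?_)
  refine (abs_rpow_mul_inner_le hr _ _).trans ?_
  refine (rpow_sub_one_mul_le hr (norm_nonneg _) (norm_nonneg _) (le_max_left _ _)
    (le_max_right _ _)).trans ?_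
  rcases max_choice ‖grad u x‖ ‖grad v x‖ with h | h <;> rw [h]
  · exact le_add_of_nonneg_right (by positivity)
  · exact le_add_of_nonneg_left (by positivity)

theorem exists_pLaplacePairing_bound (hp : 1 < p) (hp' : p ≠ ⊤) (u : W0 Ω p) :
    ∃ C : ℝ, ∀ v : W0 Ω p, ‖v‖ < 1 → |pLaplacePairing u v| ≤ C := by
  obtain ⟨M, hM, hM'⟩ := (gradL (Ω := Ω) (p := p)).bound
  refine ⟨‖gradL u‖ ^ p.toReal + M ^ p.toReal, fun v hv => ?_⟩
  refine (abs_pLaplacePairing_le hp hp' u v).trans (add_le_add_right ?_ _)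
  refine Real.rpow_le_rpow (norm_nonneg _) ((hM' v).trans ?_) ENNReal.toReal_nonneg
  exact mul_le_of_le_one_right hM.le hv.le

/-- `-Δ_p u` as a linear form. -/
def pLaplaceₗ (hp : 1 < p) (hp' : p ≠ ⊤) (u : W0 Ω p) : W0 Ω p →ₗ[ℝ] ℝ where
  toFun := pLaplacePairing u
  map_add' := pLaplacePairing_add hp hp' u
  map_smul' := pLaplacePairing_smul u

/-- `-Δ_p u` as an element of the dual space. -/
def pLaplace (hp : 1 < p) (hp' : p ≠ ⊤) (u : W0 Ω p) : StrongDual ℝ (W0 Ω p) :=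
  (pLaplaceₗ hp hp' u).mkContinuousOfExistsBound <| by
    obtain ⟨C, hC⟩ := exists_pLaplacePairing_bound hp hp' u
    exact LinearMap.bound_of_ball_bound one_pos C _ fun v hv => hC v (mem_ball_zero_iff.1 hv)

end

/-! ### Deformation along bounded fields -/

section

variable {N : ℕ} {Ω : Set (EuclideanSpace ℝ (Fin N))} {p : ℝ≥0∞} [Fact (1 ≤ p)]

/-- A continuous vector field on `W₀^{1,p}(Ω)` whose values are bounded functions that vanish
outside a fixed compact subset of `Ω` and at the points where the argument is large. -/
structure BoundedField (Ω : Set (EuclideanSpace ℝ (Fin N))) (p : ℝ≥0∞) [Fact (1 ≤ p)] where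
  Z : W0 Ω p → W0 Ω p
  cont : Continuous Z
  C : ℝ
  R : ℝ
  K : Set (EuclideanSpace ℝ (Fin N))
  hC : 0 < C
  hR : 0 < R
  hK : IsCompact K
  hKΩ : K ⊆ Ω
  bound : ∀ w, ∀ᵐ x ∂volume.restrict Ω, |fn (Z w) x| ≤ C
  supp : ∀ w, ∀ᵐ x ∂volume.restrict Ω, x ∉ K → fn (Z w) x = 0
  level : ∀ w, ∀ᵐ x ∂volume.restrict Ω, fn (Z w) x ≠ 0 → |fn w x| ≤ R

variable {f : EuclideanSpace ℝ (Fin N) → ℝ → ℝ}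

theorem aemeasurable_fn (w : W0 Ω p) : AEMeasurable (fn w) (volume.restrict Ω) :=
  (memLp_fn w).1.aemeasurable

/-- The difference quotient of `s ↦ F(x, s)` along a vector field. -/
def BoundedField.quot (B : BoundedField Ω p) (f : EuclideanSpace ℝ (Fin N) → ℝ → ℝ) (w : W0 Ω p)
    (t : ℝ) (x : EuclideanSpace ℝ (Fin N)) : ℝ :=
  fn (B.Z w) x * segAvg f x (fn w x) (t * fn (B.Z w) x)

theorem BoundedField.aemeasurable_quot (B : BoundedField Ω p) (hf : IsCaratheodory Ω f)
    (w : W0 Ω p) (t : ℝ) : AEMeasurable (B.quot f w t) (volume.restrict Ω) :=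
  (aemeasurable_fn _).mul
    (hf.aemeasurable_segAvg (aemeasurable_fn _) ((aemeasurable_fn _).const_mul t))

/-- Where the field is nonzero, the point lies in `K` and `|w| ≤ R`. For `t ≤ 1` every argument of
`f` is then at most `R + C` in absolute value, where the local sup bound applies. The bound is the
same for all `w` and `t`. -/
theorem BoundedField.exists_quot_bound (B : BoundedField Ω p) (hf : IsCaratheodory Ω f)
    (hf₀ : LocalSupIntegrable Ω f) :
    ∃ S : EuclideanSpace ℝ (Fin N) → ℝ, IntegrableOn S Ω volume ∧
      ∀ w, ∀ t ∈ Icc (0 : ℝ) 1, ∀ᵐ x ∂volume.restrict Ω, ‖B.quot f w t x‖ ≤ S x := by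
  have hR : 0 < B.R + B.C := add_pos B.hR B.hC
  obtain ⟨S, hS, hS0, hSb⟩ := hf₀.exists_bound hf hR B.hK B.hKΩ
  refine ⟨fun x => B.C * B.K.indicator S x, ?_, fun w t ht => ?_⟩
  · exact (((integrable_indicator_iff B.hK.measurableSet).2 hS).integrableOn).const_mul _
  · filter_upwards [hSb, B.bound w, B.supp w, B.level w] with x h1 h2 h3 h4
    by_cases hz : fn (B.Z w) x = 0
    · rw [quot, hz, zero_mul, norm_zero]
      exact mul_nonneg B.hC.le (indicator_nonneg (fun x _ => hS0 x) x)
    · have hxK : x ∈ B.K := by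
        by_contra h
        exact hz (h3 h)
      rw [quot, norm_mul, indicator_of_mem hxK]
      refine mul_le_mul h2 ?_ (norm_nonneg _) B.hC.le
      refine abs_segAvg_le h1 ((h4 hz).trans (le_add_of_nonneg_right B.hC.le)) ?_
      refine (abs_add_le _ _).trans (add_le_add (h4 hz) ?_)
      rw [abs_mul, abs_of_nonneg ht.1]
      exact (mul_le_of_le_one_left (abs_nonneg _) ht.2).trans h2

theorem BoundedField.integrable_quot (B : BoundedField Ω p) (hf : IsCaratheodory Ω f)
    (hf₀ : LocalSupIntegrable Ω f) (w : W0 Ω p) {t : ℝ} (ht : t ∈ Icc (0 : ℝ) 1) :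
    IntegrableOn (B.quot f w t) Ω volume := by
  obtain ⟨S, hS, hSb⟩ := B.exists_quot_bound hf hf₀
  exact hS.mono' (B.aemeasurable_quot hf w t).aestronglyMeasurable (hSb w t ht)

set_option maxHeartbeats 1000000 in
theorem BoundedField.tendsto_integral_quot (B : BoundedField Ω p) (hf : IsCaratheodory Ω f)
    (hf₀ : LocalSupIntegrable Ω f) (u : W0 Ω p) :
    Tendsto (fun q : W0 Ω p × ℝ => ∫ x in Ω, B.quot f q.1 q.2 x)
      (𝓝 u ×ˢ 𝓝[Icc 0 1] 0) (𝓝 (∫ x in Ω, f x (fn u x) * fn (B.Z u) x)) := by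
  obtain ⟨S, hS, hSb⟩ := B.exists_quot_bound hf hf₀
  refine tendsto_of_seq_tendsto fun q hq => tendsto_of_subseq_tendsto fun ns hns => ?_
  have hq' := hq.comp hns
  have hw : Tendsto (fun n => (q (ns n)).1) atTop (𝓝 u) := tendsto_fst.comp hq'
  have ht : Tendsto (fun n => (q (ns n)).2) atTop (𝓝[Icc 0 1] 0) := tendsto_snd.comp hq'
  have ht' := tendsto_nhdsWithin_iff.1 ht
  obtain ⟨m₁, hm₁, hl₁⟩ := exists_subseq_fn hw
  have hz : Tendsto (fun n => B.Z (q (ns (m₁ n))).1) atTop (𝓝 (B.Z u)) :=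
    (B.cont.tendsto u).comp (hw.comp hm₁.tendsto_atTop)
  obtain ⟨m₂, hm₂, hl₂⟩ := exists_subseq_fn hz
  have hm : Tendsto (fun n => m₁ (m₂ n)) atTop atTop := hm₁.tendsto_atTop.comp hm₂.tendsto_atTop
  refine ⟨fun n => m₁ (m₂ n), tendsto_integral_filter_of_dominated_convergence S
    (Eventually.of_forall fun n => (B.aemeasurable_quot hf _ _).aestronglyMeasurable) ?_ hS ?_⟩
  · filter_upwards [hm.eventually ht'.2] with n hn
    exact hSb _ _ hn
  · filter_upwards [hl₁, hl₂, hf.2] with x h1 h2 h3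
    have h1' := h1.comp hm₂.tendsto_atTop
    have h4 : Tendsto (fun n => (q (ns (m₁ (m₂ n)))).2 * fn (B.Z (q (ns (m₁ (m₂ n)))).1) x) atTop
        (𝓝 0) := by
      simpa using (ht'.1.comp hm).mul h2
    have h5 := ((continuous_segAvg h3).tendsto (fn u x, 0)).comp (h1'.prodMk_nhds h4)
    rw [segAvg_zero] at h5
    have h6 := h2.mul h5
    rw [mul_comm (f x (fn u x))]
    exact h6

theorem extIntegral_congr {α : Type*} [MeasurableSpace α] {μ : Measure α} {g k : α → ℝ}
    (h : g =ᵐ[μ] k) : extIntegral μ g = extIntegral μ k := by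
  have h1 : ∫⁻ x, ENNReal.ofReal (g x) ∂μ = ∫⁻ x, ENNReal.ofReal (k x) ∂μ :=
    lintegral_congr_ae (h.mono fun x hx => by simp only [hx])
  have h2 : ∫⁻ x, ENNReal.ofReal (-g x) ∂μ = ∫⁻ x, ENNReal.ofReal (-k x) ∂μ :=
    lintegral_congr_ae (h.mono fun x hx => by simp only [hx])
  rw [extIntegral, extIntegral, h1, h2]

/-- The increment is finite even when neither side's main term is, which lets the deformation act on
the whole epigraph near `u`. -/
theorem BoundedField.extIntegral_step (B : BoundedField Ω p) (hf : IsCaratheodory Ω f)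
    (hf₀ : LocalSupIntegrable Ω f) (w : W0 Ω p) {t : ℝ} (ht : t ∈ Icc (0 : ℝ) 1) :
    extIntegral (volume.restrict Ω) (fun x => -primitive f x (fn (w + t • B.Z w) x)) =
      extIntegral (volume.restrict Ω) (fun x => -primitive f x (fn w x)) +
        ((-(t * ∫ x in Ω, B.quot f w t x) : ℝ) : EReal) := by
  have hg : AEMeasurable (fun x => -primitive f x (fn w x)) (volume.restrict Ω) :=
    (hf.aemeasurable_primitive (aemeasurable_fn w)).neg
  rw [← neg_mul, ← integral_const_mul, ← extIntegral_add hg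
    ((B.integrable_quot hf hf₀ w ht).const_mul (-t))]
  refine extIntegral_congr ?_
  filter_upwards [fn_add w (t • B.Z w), fn_smul t (B.Z w), hf.2] with x h1 h2 h3
  have := primitive_add_sub h3 (fn w x) (t * fn (B.Z w) x)
  rw [h1, h2, quot]
  linarith

/-- Here `X` is the integral of `-F(x, w)`: the value `⊤` is excluded by the epigraph bound, and for
`⊥` the new value of the functional is `⊥`. -/
theorem ereal_step_le {X : EReal} {a b c d e m n : ℝ} (h : (a : EReal) - -X - b ≤ m)
    (h' : c + d - e - n ≤ a - b - m) : (c : EReal) - -(X + (d : ℝ)) - (e : ℝ) ≤ (n : ℝ) := by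
  induction X with
  | bot => simp
  | top => simp at h
  | coe x =>
    norm_cast at h ⊢
    linarith

theorem BoundedField.phi_step_le (B : BoundedField Ω p) (hf : IsCaratheodory Ω f)
    (hf₀ : LocalSupIntegrable Ω f) (h : StrongDual ℝ (W0 Ω p)) (w : W0 Ω p) {t δ : ℝ}
    (ht : t ∈ Icc (0 : ℝ) 1)
    (hd : energy (w + t • B.Z w) - energy w - t * (∫ x in Ω, B.quot f w t x) - t * h (B.Z w) ≤
      -(δ * t)) {μ : ℝ} (hμ : Phi f h w ≤ (μ : EReal)) :
    Phi f h (w + t • B.Z w) ≤ ((μ - δ * t : ℝ) : EReal) := by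
  have e1 : ∀ y : W0 Ω p, Phi f h y = ((energy y : ℝ) : EReal) - Psi f y - (h y : EReal) :=
    fun _ => rfl
  have e2 : h (w + t • B.Z w) = h w + t * h (B.Z w) := by
    rw [map_add, map_smul, smul_eq_mul]
  rw [e1, Psi] at hμ
  rw [e1, Psi, B.extIntegral_step hf hf₀ w ht]
  refine ereal_step_le hμ ?_
  rw [e2]
  linarith

-- The deformation is `w + t Z(w)`. Each of the three terms of the functional decreases along it at
-- the rate found at `u`, up to an error `ε t`, uniformly for `w` near `u` and small `t`.
set_option maxHeartbeats 1000000 in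
theorem BoundedField.isDeltaRegular (B : BoundedField Ω p) (hp : 1 < p) (hp' : p ≠ ⊤)
    (hf : IsCaratheodory Ω f) (hf₀ : LocalSupIntegrable Ω f) (h : StrongDual ℝ (W0 Ω p))
    {u : W0 Ω p} (hu : ∃ r : ℝ, Phi f h u = (r : EReal)) (hZ : ‖B.Z u‖ < 1) {δ : ℝ}
    (hδ : pLaplacePairing u (B.Z u) - (∫ x in Ω, f x (fn u x) * fn (B.Z u) x) - h (B.Z u) < -δ) :
    IsDeltaRegular (Phi f h) u δ := by
  obtain ⟨r, hr⟩ := hu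
  set I : ℝ := ∫ x in Ω, f x (fn u x) * fn (B.Z u) x with hI
  -- One `ε` for each of the energy, the integral of `f` and the form `h`.
  obtain ⟨ε, hε, hεL⟩ : ∃ ε : ℝ, 0 < ε ∧
      pLaplacePairing u (B.Z u) - I - h (B.Z u) + 3 * ε ≤ -δ :=
    ⟨(-δ - (pLaplacePairing u (B.Z u) - I - h (B.Z u))) / 3, by linarith, by linarith⟩
  obtain ⟨s, hs, hsE⟩ := exists_energy_slope_lt hp hp' u (B.Z u) hε
  have hcE : Continuous fun w : W0 Ω p => (energy (w + s • B.Z w) - energy w) / s :=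
    (((continuous_energy hp hp').comp (continuous_id.add (B.cont.const_smul s))).sub
      (continuous_energy hp hp')).div_const s
  have ev1 : ∀ᶠ w in 𝓝 u, (energy (w + s • B.Z w) - energy w) / s <
      pLaplacePairing u (B.Z u) + ε := hcE.continuousAt.eventually_lt_const hsE
  have ev2 : ∀ᶠ w in 𝓝 u, h (B.Z u) - ε < h (B.Z w) :=
    (h.continuous.comp B.cont).continuousAt.eventually_const_lt (sub_lt_self _ hε)
  have ev3 : ∀ᶠ w in 𝓝 u, ‖B.Z w‖ < 1 := B.cont.norm.continuousAt.eventually_lt_const hZ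
  have ev4 : ∀ᶠ q in 𝓝 u ×ˢ 𝓝[Icc 0 1] (0 : ℝ), I - ε < ∫ x in Ω, B.quot f q.1 q.2 x :=
    (B.tendsto_integral_quot hf hf₀ u).eventually_const_lt (sub_lt_self _ hε)
  obtain ⟨Pa, hPa, Pb, hPb, hP⟩ := eventually_prod_iff.1 ev4
  obtain ⟨σ₁, hσ₁, hb₁⟩ := Metric.eventually_nhds_iff.1 (((ev1.and ev2).and ev3).and hPa)
  obtain ⟨σ₂, hσ₂, hb₂⟩ := Metric.eventually_nhds_iff.1 (eventually_nhdsWithin_iff.1 hPb)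
  -- `σ₂` is halved since `t = σ` is allowed, `s` is the range of the energy slope bound, and `1`
  -- that of the bound on the quotients.
  let σ : ℝ := min (min σ₁ (σ₂ / 2)) (min s 1)
  have hσ : 0 < σ := lt_min (lt_min hσ₁ (half_pos hσ₂)) (lt_min hs one_pos)
  have hσ1 : σ ≤ σ₁ := (min_le_left _ _).trans (min_le_left _ _)
  have hσ2 : σ ≤ σ₂ / 2 := (min_le_left _ _).trans (min_le_right _ _)
  have hσs : σ ≤ s := (min_le_right _ _).trans (min_le_left _ _)
  have hσ1' : σ ≤ 1 := (min_le_right _ _).trans (min_le_right _ _)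
  refine ⟨r, hr, σ, hσ, fun q => q.1.1 + q.2 • B.Z q.1.1, ?_, ?_⟩
  · refine Continuous.continuousOn ?_
    exact (continuous_fst.comp continuous_fst).add
      (continuous_snd.smul (B.cont.comp (continuous_fst.comp continuous_fst)))
  · rintro ⟨w, μ⟩ ⟨hqμ, hq⟩ t ht
    simp only at hqμ hq ⊢
    have hw : dist w u < σ₁ := by
      refine lt_of_le_of_lt ?_ (hq.trans_le hσ1)
      exact Real.le_sqrt_of_sq_le (le_add_of_nonneg_right (sq_nonneg _))
    have ht01 : t ∈ Icc (0 : ℝ) 1 := ⟨ht.1, ht.2.trans hσ1'⟩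
    have ht2 : dist t 0 < σ₂ := by
      rw [Real.dist_eq, sub_zero, abs_of_nonneg ht.1]
      linarith [ht.2]
    obtain ⟨⟨⟨a1, a2⟩, a3⟩, a4⟩ := hb₁ hw
    have a5 : I - ε < ∫ x in Ω, B.quot f w t x := hP a4 (hb₂ ht2 ht01)
    have a6 := energy_slope_mono hp hp' w (B.Z w) ht.1 (ht.2.trans hσs) hs
    constructor
    · rw [dist_eq_norm, add_sub_cancel_left, norm_smul, Real.norm_of_nonneg ht.1]
      exact mul_le_of_le_one_right ht.1 a3.le
    · refine B.phi_step_le hf hf₀ h w ht01 ?_ hqμ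
      have b1 := mul_le_mul_of_nonneg_left a1.le ht.1
      have b2 := mul_le_mul_of_nonneg_left a2.le ht.1
      have b3 := mul_le_mul_of_nonneg_left a5.le ht.1
      have b4 := mul_le_mul_of_nonneg_left hεL ht.1
      linarith

theorem not_isDeltaRegular_of_isCritical {E : Type*} [MetricSpace E] {φ : E → EReal} {u : E}
    (hu : IsCritical φ u) {δ : ℝ} (hδ : 0 < δ) : ¬ IsDeltaRegular φ u δ := by
  intro h
  have h1 : ENNReal.ofReal δ ≤ weakSlope φ u := le_iSup₂_of_le δ ⟨hδ, h⟩ le_rfl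
  rw [hu.2, nonpos_iff_eq_zero, ENNReal.ofReal_eq_zero] at h1
  exact h1.not_gt hδ

/-! ### The equation on `V_u` -/

theorem deriv_bump_eq_zero_of_le {r : ℝ} (h : |r| ≤ 1) : deriv bump r = 0 := by
  have : IsLocalMax bump r :=
    Eventually.of_forall fun x => by rw [bump_eq_one h]; exact bump.le_one
  exact this.deriv_eq_zero

theorem abs_fn_cutoff_le (hp' : p ≠ ⊤) {R C : ℝ} (hR : 0 < R) (hC : 0 < C) (w v : W0 Ω p) :
    ∀ᵐ x ∂volume.restrict Ω, |fn ((cutoff R C hR hC).app hp' w v) x| ≤ |fn v x| := by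
  filter_upwards [(cutoff R C hR hC).fn_app hp' w v] with x hx
  rw [hx, abs_mul]
  exact mul_le_of_le_one_left (abs_nonneg _) (abs_cutoff_c_le _ _ _ _ _)

theorem abs_le_of_fn_cutoff_ne_zero (hp' : p ≠ ⊤) {R C : ℝ} (hR : 0 < R) (hC : 0 < C)
    (w v : W0 Ω p) : ∀ᵐ x ∂volume.restrict Ω,
      fn ((cutoff R C hR hC).app hp' w v) x ≠ 0 → |fn w x| ≤ 2 * R := by
  filter_upwards [(cutoff R C hR hC).fn_app hp' w v] with x hx hne
  by_contra hlt
  refine hne ?_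
  rw [hx, cutoff_c, bump_eq_zero, zero_mul, zero_mul]
  rw [abs_div, abs_of_pos hR, le_div_iff₀ hR]
  exact (not_le.1 hlt).le

/-- Both cutoffs equal `1` on `{v ≠ 0}`. On `{v = 0}` nothing is known about `u`, but there `∇v`
vanishes a.e. -/
theorem cutoff_app_eq_self (hp' : p ≠ ⊤) {R C : ℝ} (hR : 0 < R) (hC : 0 < C) {u v : W0 Ω p}
    (hv : ∀ᵐ x ∂volume.restrict Ω, |fn v x| ≤ C)
    (hu : ∀ᵐ x ∂volume.restrict Ω, fn v x ≠ 0 → |fn u x| ≤ R) :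
    (cutoff R C hR hC).app hp' u v = v := by
  have h1 : ∀ᵐ x ∂volume.restrict Ω, |fn v x / C| ≤ 1 := by
    filter_upwards [hv] with x hx
    rwa [abs_div, abs_of_pos hC, div_le_one hC]
  have h2 : ∀ᵐ x ∂volume.restrict Ω, fn v x ≠ 0 → |fn u x / R| ≤ 1 := by
    filter_upwards [hu] with x hx hne
    rw [abs_div, abs_of_pos hR, div_le_one hR]
    exact hx hne
  refine W0_ext ?_ ?_
  · filter_upwards [(cutoff R C hR hC).fn_app hp' u v, h1, h2] with x hx a1 a2
    by_cases hz : fn v x = 0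
    · rw [hx, hz, mul_zero]
    · rw [hx, cutoff_c, bump_eq_one a1, bump_eq_one (a2 hz), one_mul, one_mul]
  · filter_upwards [(cutoff R C hR hC).grad_app hp' u v, h1, h2,
      grad_ae_eq_zero_of_fn_eq_zero hp' v] with x hx a1 a2 a3
    by_cases hz : fn v x = 0
    · rw [hx, a3 hz, hz, cutoff_a]
      simp
    · rw [hx, cutoff_a, cutoff_b, bump_eq_one a1, bump_eq_one (a2 hz),
        deriv_bump_eq_zero_of_le a1, deriv_bump_eq_zero_of_le (a2 hz)]
      simp

theorem Multiplier.continuous_app_left (M : Multiplier) (hp' : p ≠ ⊤) (v : W0 Ω p) :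
    Continuous fun w => M.app hp' w v := by
  have h : Continuous fun w : W0 Ω p => (w, v) := by fun_prop
  exact (M.continuous_app hp').comp h

/-- The field `w ↦ β(w / R) β(v / C) v`. -/
def cutoffField (hp' : p ≠ ⊤) {R C : ℝ} (hR : 0 < R) (hC : 0 < C) (v : W0 Ω p)
    (hv : ∀ᵐ x ∂volume.restrict Ω, |fn v x| ≤ C) {K : Set (EuclideanSpace ℝ (Fin N))}
    (hK : IsCompact K) (hKΩ : K ⊆ Ω) (hKv : ∀ᵐ x ∂volume.restrict Ω, x ∉ K → fn v x = 0) :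
    BoundedField Ω p where
  Z w := (cutoff R C hR hC).app hp' w v
  cont := (cutoff R C hR hC).continuous_app_left hp' v
  C := C
  R := 2 * R
  K := K
  hC := hC
  hR := mul_pos two_pos hR
  hK := hK
  hKΩ := hKΩ
  bound w := by
    filter_upwards [hv, abs_fn_cutoff_le hp' hR hC w v] with x h1 h2
    exact h2.trans h1
  supp w := by
    filter_upwards [hKv, (cutoff R C hR hC).fn_app hp' w v] with x h1 h2 hx
    rw [h2, h1 hx, mul_zero]
  level w := abs_le_of_fn_cutoff_ne_zero hp' hR hC w v

theorem exists_boundedField (hp' : p ≠ ⊤) {u v : W0 Ω p} (hv : v ∈ testV u) :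
    ∃ B : BoundedField Ω p, B.Z u = v := by
  obtain ⟨⟨C, hC⟩, ⟨K, hK, hKΩ, hKv⟩, M, hM⟩ := hv
  have hC0 : 0 < max C 1 := lt_max_of_lt_right one_pos
  have hR0 : 0 < max M 1 := lt_max_of_lt_right one_pos
  have hC' : ∀ᵐ x ∂volume.restrict Ω, |fn v x| ≤ max C 1 :=
    hC.mono fun x hx => hx.trans (le_max_left _ _)
  exact ⟨cutoffField hp' hR0 hC0 v hC' hK hKΩ hKv,
    cutoff_app_eq_self hp' hR0 hC0 hC' (hM.mono fun x hx hne => (hx hne).trans (le_max_left _ _))⟩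

theorem smul_mem_testV {u v : W0 Ω p} (hv : v ∈ testV u) (c : ℝ) : c • v ∈ testV u := by
  obtain ⟨⟨C, hC⟩, ⟨K, hK, hKΩ, hKv⟩, M, hM⟩ := hv
  refine ⟨⟨|c| * C, ?_⟩, ⟨K, hK, hKΩ, ?_⟩, M, ?_⟩
  · filter_upwards [hC, fn_smul c v] with x h1 h2
    rw [h2, abs_mul]
    gcongr
  · filter_upwards [hKv, fn_smul c v] with x h1 h2 hx
    rw [h2, h1 hx, mul_zero]
  · filter_upwards [hM, fn_smul c v] with x h1 h2 hx
    exact h1 fun h0 => hx (by rw [h2, h0, mul_zero])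

theorem testV_subset_testA (hf : IsCaratheodory Ω f) (hf₀ : LocalSupIntegrable Ω f)
    {u v : W0 Ω p} (hv : v ∈ testV u) : v ∈ testA f u := by
  obtain ⟨⟨C, hC⟩, ⟨K, hK, hKΩ, hKv⟩, M, hM⟩ := hv
  have hR0 : 0 < max M 1 := lt_max_of_lt_right one_pos
  obtain ⟨S, hS, hS0, hSb⟩ := hf₀.exists_bound hf hR0 hK hKΩ
  have hi : IntegrableOn (fun x => K.indicator S x * |C|) Ω volume :=
    (((integrable_indicator_iff hK.measurableSet).2 hS).integrableOn).mul_const _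
  refine hi.mono' ((hf.aemeasurable_comp (aemeasurable_fn u)).mul
    (aemeasurable_fn v)).aestronglyMeasurable ?_
  filter_upwards [hC, hKv, hM, hSb] with x h1 h2 h3 h4
  by_cases hz : fn v x = 0
  · rw [hz, mul_zero, norm_zero]
    exact mul_nonneg (indicator_nonneg (fun x _ => hS0 x) x) (abs_nonneg _)
  · have hxK : x ∈ K := by
      by_contra h
      exact hz (h2 h)
    rw [norm_mul, indicator_of_mem hxK]
    exact mul_le_mul (h4 _ ((h3 hz).trans (le_max_left _ _))) (h1.trans (le_abs_self _))
      (norm_nonneg _) (hS0 x)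

theorem integral_mul_fn_smul (f : EuclideanSpace ℝ (Fin N) → ℝ → ℝ) (u v : W0 Ω p) (c : ℝ) :
    ∫ x in Ω, f x (fn u x) * fn (c • v) x = c * ∫ x in Ω, f x (fn u x) * fn v x := by
  rw [← integral_const_mul]
  refine integral_congr_ae ?_
  filter_upwards [fn_smul c v] with x hx
  rw [hx]
  ring

theorem nonneg_of_isCritical (hp : 1 < p) (hp' : p ≠ ⊤) (hf : IsCaratheodory Ω f)
    (hf₀ : LocalSupIntegrable Ω f) {h : StrongDual ℝ (W0 Ω p)} {u v : W0 Ω p}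
    (hu : IsCritical (Phi f h) u) (hv : v ∈ testV u) :
    0 ≤ pLaplacePairing u v - (∫ x in Ω, f x (fn u x) * fn v x) - h v := by
  by_contra hneg
  rw [not_le] at hneg
  -- The scaling makes the direction shorter than `1`, so that a step of parameter `t` moves by at
  -- most `t`.
  set c : ℝ := (‖v‖ + 1)⁻¹ with hc
  have hc0 : 0 < c := by positivity
  obtain ⟨B, hB⟩ := exists_boundedField hp' (smul_mem_testV hv c)
  set L := pLaplacePairing u v - (∫ x in Ω, f x (fn u x) * fn v x) - h v with hL
  have hcL : c * L < 0 := mul_neg_of_pos_of_neg hc0 hneg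
  refine not_isDeltaRegular_of_isCritical hu (δ := -(c * L) / 2) (by linarith)
    (B.isDeltaRegular hp hp' hf hf₀ h hu.1 ?_ ?_)
  · rw [hB, norm_smul, Real.norm_of_nonneg hc0.le, hc, inv_mul_lt_iff₀ (by positivity)]
    linarith
  · rw [hB, pLaplacePairing_smul, integral_mul_fn_smul, map_smul, smul_eq_mul, ← mul_sub,
      ← mul_sub, ← hL]
    linarith

theorem eq_of_isCritical (hp : 1 < p) (hp' : p ≠ ⊤) (hf : IsCaratheodory Ω f)
    (hf₀ : LocalSupIntegrable Ω f) {h : StrongDual ℝ (W0 Ω p)} {u v : W0 Ω p}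
    (hu : IsCritical (Phi f h) u) (hv : v ∈ testV u) :
    pLaplacePairing u v - h v = ∫ x in Ω, f x (fn u x) * fn v x := by
  have h1 := nonneg_of_isCritical hp hp' hf hf₀ hu hv
  have h2 := nonneg_of_isCritical hp hp' hf hf₀ hu (smul_mem_testV hv (-1))
  rw [pLaplacePairing_smul, integral_mul_fn_smul, map_smul, smul_eq_mul] at h2
  linarith

end

/-! ### Density of `V_u` and extension of the integral formula to `A_u` -/

section

variable {N : ℕ} {Ω : Set (EuclideanSpace ℝ (Fin N))} {p : ℝ≥0∞} [Fact (1 ≤ p)]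
  {f : EuclideanSpace ℝ (Fin N) → ℝ → ℝ}

/-- Bounded elements of `W₀^{1,p}(Ω)` that vanish a.e. outside a compact subset of `Ω`. -/
structure IsBoundedCompact (v : W0 Ω p) : Prop where
  bounded : ∃ C : ℝ, ∀ᵐ x ∂(volume.restrict Ω), |fn v x| ≤ C
  compact : ∃ K : Set (EuclideanSpace ℝ (Fin N)), IsCompact K ∧ K ⊆ Ω ∧
    ∀ᵐ x ∂(volume.restrict Ω), x ∉ K → fn v x = 0

theorem exists_seq_isBoundedCompact (w : W0 Ω p) :
    ∃ φ : ℕ → W0 Ω p, (∀ n, IsBoundedCompact (φ n)) ∧ Tendsto φ atTop (𝓝 w) := by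
  obtain ⟨y, hy, hyw⟩ := mem_closure_iff_seq_limit.1 w.2
  have hmem : ∀ n, y n ∈ W0 Ω p := fun n => (testPairs Ω p).le_topologicalClosure (hy n)
  refine ⟨fun n => ⟨y n, hmem n⟩, fun n => ?_, tendsto_subtype_rng.2 hyw⟩
  obtain ⟨φ, hφ, ha, -⟩ := hy n
  have ha' : fn (⟨y n, hmem n⟩ : W0 Ω p) =ᵐ[volume.restrict Ω] φ := ha
  refine ⟨?_, tsupport φ, hφ.compact, hφ.supp, ?_⟩
  · obtain ⟨C, hC⟩ := hφ.compact.exists_bound_of_continuous hφ.smooth.continuous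
    refine ⟨C, ?_⟩
    filter_upwards [ha'] with x hx
    rw [hx]
    exact hC x
  · filter_upwards [ha'] with x hx hxK
    rw [hx]
    exact image_eq_zero_of_notMem_tsupport hxK

theorem cutoff_mem_testV (hp' : p ≠ ⊤) {R C : ℝ} (hR : 0 < R) (hC : 0 < C) (u : W0 Ω p)
    {v : W0 Ω p} (hv : IsBoundedCompact v) : (cutoff R C hR hC).app hp' u v ∈ testV u := by
  obtain ⟨⟨M, hM⟩, K, hK, hKΩ, hKv⟩ := hv
  refine ⟨⟨M, ?_⟩, ⟨K, hK, hKΩ, ?_⟩, 2 * R, abs_le_of_fn_cutoff_ne_zero hp' hR hC u v⟩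
  · filter_upwards [hM, abs_fn_cutoff_le hp' hR hC u v] with x h1 h2
    exact h2.trans h1
  · filter_upwards [hKv, (cutoff R C hR hC).fn_app hp' u v] with x h1 h2 hx
    rw [h2, h1 hx, mul_zero]

set_option maxHeartbeats 1000000 in
theorem tendsto_cutoff (hp' : p ≠ ⊤) (u : W0 Ω p) {v : W0 Ω p} {C : ℝ} (hC : 0 < C)
    (hv : ∀ᵐ x ∂volume.restrict Ω, |fn v x| ≤ C) :
    Tendsto (fun n : ℕ => (cutoff ((n : ℝ) + 1) C (by positivity) hC).app hp' u v) atTop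
      (𝓝 v) := by
  have hD := bumpBound_nonneg
  have hlarge : ∀ s : ℝ, ∀ᶠ n : ℕ in atTop, |s / ((n : ℝ) + 1)| ≤ 1 := by
    intro s
    have : Tendsto (fun n : ℕ => (n : ℝ) + 1) atTop atTop :=
      tendsto_atTop_add_const_right _ _ tendsto_natCast_atTop_atTop
    filter_upwards [this.eventually_ge_atTop |s|] with n hn
    have : (0 : ℝ) < (n : ℝ) + 1 := by positivity
    rwa [abs_div, abs_of_pos this, div_le_one this]
  have h1 : ∀ᵐ x ∂volume.restrict Ω, |fn v x / C| ≤ 1 := by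
    filter_upwards [hv] with x hx
    rwa [abs_div, abs_of_pos hC, div_le_one hC]
  refine Multiplier.tendsto_app hp' _ u v v (K := 1 + 2 * bumpBound + bumpBound * (2 * C))
    (fun n q => (abs_cutoff_c_le _ _ _ _ q).trans (by nlinarith)) (fun n => ?_) ?_ ?_
  · refine Eventually.of_forall fun x => ?_
    refine (norm_add_le _ _).trans ?_
    rw [norm_smul, norm_smul, mul_add]
    refine add_le_add (mul_le_mul_of_nonneg_right ?_ (norm_nonneg _))
      (mul_le_mul_of_nonneg_right ?_ (norm_nonneg _))
    · refine (cutoff_a_bound (by positivity) hC _).trans ?_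
      have : bumpBound / ((n : ℝ) + 1) ≤ bumpBound := div_le_self hD (by simp)
      nlinarith
    · refine (cutoff_b_bound _ _ _).trans ?_
      nlinarith
  · filter_upwards [h1] with x hx
    refine tendsto_const_nhds.congr' ?_
    filter_upwards [hlarge (fn u x)] with n hn
    rw [cutoff_c, bump_eq_one hn, bump_eq_one hx, one_mul, one_mul]
  · filter_upwards [h1] with x hx
    refine tendsto_const_nhds.congr' ?_
    filter_upwards [hlarge (fn u x)] with n hn
    rw [cutoff_a, cutoff_b, bump_eq_one hn, bump_eq_one hx, deriv_bump_eq_zero_of_le hn,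
      deriv_bump_eq_zero_of_le hx]
    simp

theorem exists_seq_testV (hp' : p ≠ ⊤) (u : W0 Ω p) {v : W0 Ω p} (hv : IsBoundedCompact v) :
    ∃ y : ℕ → W0 Ω p, (∀ n, y n ∈ testV u) ∧
      (∀ n, ∀ᵐ x ∂volume.restrict Ω, |fn (y n) x| ≤ |fn v x|) ∧ Tendsto y atTop (𝓝 v) := by
  obtain ⟨C, hC⟩ := hv.bounded
  have hC0 : 0 < max C 1 := lt_max_of_lt_right one_pos
  exact ⟨_, fun n => cutoff_mem_testV hp' (by positivity) hC0 u hv,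
    fun n => abs_fn_cutoff_le hp' (by positivity) hC0 u v,
    tendsto_cutoff hp' u hC0 (hC.mono fun x hx => hx.trans (le_max_left _ _))⟩

/-- Test functions are dense, and each of them is the limit of its cutoffs at the levels of `u`. -/
theorem dense_testV (hp' : p ≠ ⊤) (u : W0 Ω p) : Dense (testV u) := by
  intro w
  obtain ⟨φ, hφ, hφw⟩ := exists_seq_isBoundedCompact w
  rw [← closure_closure]
  refine mem_closure_of_tendsto hφw (Eventually.of_forall fun n => ?_)
  obtain ⟨y, hy, -, hyl⟩ := exists_seq_testV hp' u (hφ n)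
  exact mem_closure_of_tendsto hyl (Eventually.of_forall hy)

/-- The comparison with `|v|` makes `|f(x,u) v|` an integrable majorant, so the representation of
`T` passes to norm limits. -/
theorem eq_integral_of_tendsto (hf : IsCaratheodory Ω f) {u v : W0 Ω p} (hv : v ∈ testA f u)
    (T : StrongDual ℝ (W0 Ω p)) {y : ℕ → W0 Ω p} {z : W0 Ω p} (hyz : Tendsto y atTop (𝓝 z))
    (hle : ∀ n, ∀ᵐ x ∂volume.restrict Ω, |fn (y n) x| ≤ |fn v x|)
    (hT : ∀ n, T (y n) = ∫ x in Ω, f x (fn u x) * fn (y n) x) :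
    T z = ∫ x in Ω, f x (fn u x) * fn z x := by
  obtain ⟨m, hm, hl⟩ := exists_subseq_fn hyz
  have h1 : Tendsto (fun n => T (y (m n))) atTop (𝓝 (T z)) :=
    (T.continuous.tendsto z).comp (hyz.comp hm.tendsto_atTop)
  have h2 : Tendsto (fun n => T (y (m n))) atTop (𝓝 (∫ x in Ω, f x (fn u x) * fn z x)) := by
    simp only [hT]
    refine tendsto_integral_of_dominated_convergence (fun x => ‖f x (fn u x) * fn v x‖)
      (fun n => ((hf.aemeasurable_comp (aemeasurable_fn u)).mul
        (aemeasurable_fn _)).aestronglyMeasurable) (Integrable.norm hv) (fun n => ?_) ?_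
    · filter_upwards [hle (m n)] with x hx
      rw [norm_mul, norm_mul]
      exact mul_le_mul_of_nonneg_left hx (norm_nonneg _)
    · filter_upwards [hl] with x hx
      exact hx.const_mul _
  exact tendsto_nhds_unique h1 h2

theorem eq_integral_of_isBoundedCompact (hp' : p ≠ ⊤) (hf : IsCaratheodory Ω f) {u v : W0 Ω p}
    (hv : v ∈ testA f u) {T : StrongDual ℝ (W0 Ω p)} (hT : IsExtension f u T) {z : W0 Ω p}
    (hz : IsBoundedCompact z) (hle : ∀ᵐ x ∂volume.restrict Ω, |fn z x| ≤ |fn v x|) :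
    T z = ∫ x in Ω, f x (fn u x) * fn z x := by
  obtain ⟨y, hy, hyle, hyl⟩ := exists_seq_testV hp' u hz
  refine eq_integral_of_tendsto hf hv T hyl (fun n => ?_) fun n => (hT _ (hy n)).2
  filter_upwards [hyle n, hle] with x h1 h2
  exact h1.trans h2

theorem abs_fn_pinch_le (hp' : p ≠ ⊤) {e : ℝ} (he : 0 < e) (w v : W0 Ω p) :
    ∀ᵐ x ∂volume.restrict Ω, |fn ((pinch e he).app hp' w v) x| ≤ |fn v x| := by
  filter_upwards [(pinch e he).fn_app hp' w v] with x hx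
  rw [hx, abs_mul]
  exact mul_le_of_le_one_left (abs_nonneg _) (abs_pinch_c_le he _)

theorem isBoundedCompact_pinch (hp' : p ≠ ⊤) {e : ℝ} (he : 0 < e) {w : W0 Ω p}
    (hw : IsBoundedCompact w) (v : W0 Ω p) :
    IsBoundedCompact ((pinch e he).app hp' w v) := by
  obtain ⟨⟨C, hC⟩, K, hK, hKΩ, hKw⟩ := hw
  have h : ∀ᵐ x ∂volume.restrict Ω, |fn ((pinch e he).app hp' w v) x| ≤ 2 * |fn w x| := by
    filter_upwards [(pinch e he).fn_app hp' w v] with x hx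
    rw [hx]
    exact abs_pinch_c_mul_le he (fn w x, fn v x)
  refine ⟨⟨2 * C, ?_⟩, K, hK, hKΩ, ?_⟩
  · filter_upwards [h, hC] with x h1 h2
    linarith
  · filter_upwards [h, hKw] with x h1 h2 hx
    rw [h2 hx, abs_zero, mul_zero] at h1
    exact abs_nonpos_iff.1 h1

theorem tendsto_sq_div {t : ℝ} (ht : t ≠ 0) :
    Tendsto (fun n : ℕ => t ^ 2 / (t ^ 2 + t ^ 2 + (1 / ((n : ℝ) + 1)) ^ 2)) atTop
      (𝓝 (1 / 2)) := by
  have h1 : Tendsto (fun n : ℕ => t ^ 2 + t ^ 2 + (1 / ((n : ℝ) + 1)) ^ 2) atTop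
      (𝓝 (t ^ 2 + t ^ 2 + 0 ^ 2)) :=
    (tendsto_one_div_add_atTop_nhds_zero_nat.pow 2).const_add _
  have h2 : t ^ 2 / (t ^ 2 + t ^ 2 + 0 ^ 2) = 1 / 2 := by
    field_simp
    ring
  rw [← h2]
  exact tendsto_const_nhds.div h1 (by positivity)

set_option maxHeartbeats 1000000 in
theorem tendsto_pinch (hp' : p ≠ ⊤) (v : W0 Ω p) :
    Tendsto (fun n : ℕ => (pinch (1 / ((n : ℝ) + 1)) (by positivity)).app hp' v v) atTop
      (𝓝 v) := by
  have hc : ∀ t e : ℝ, 2 * t * t / (t ^ 2 + t ^ 2 + e ^ 2) =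
      2 * (t ^ 2 / (t ^ 2 + t ^ 2 + e ^ 2)) := fun t e => by ring
  refine Multiplier.tendsto_app hp' _ v v v (K := 4)
    (fun n q => (abs_pinch_c_le _ q).trans (by norm_num)) (fun n => ?_) ?_ ?_
  · refine Eventually.of_forall fun x => ?_
    refine (norm_add_le _ _).trans ?_
    rw [norm_smul, norm_smul, mul_add]
    exact add_le_add (mul_le_mul_of_nonneg_right
      ((pinch_a_bound (by positivity) _).trans (by norm_num)) (norm_nonneg _))
      (mul_le_mul_of_nonneg_right (pinch_b_bound (by positivity) _) (norm_nonneg _))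
  · refine Eventually.of_forall fun x => ?_
    by_cases hz : fn v x = 0
    · simp [hz]
    · simp only [pinch_c, hc]
      simpa using ((tendsto_sq_div hz).const_mul 2).mul_const (fn v x)
  · filter_upwards [grad_ae_eq_zero_of_fn_eq_zero hp' v] with x hx
    by_cases hz : fn v x = 0
    · simp [hx hz]
    -- On the diagonal `s = t ≠ 0` the ratio `t²/Q` tends to `1/2`, so `a → 0` and `b → 1`.
    · simp only [pinch_a, pinch_b, hc, ← add_smul]
      have h := tendsto_sq_div hz
      have h1 := (((h.const_mul 2).sub ((h.const_mul 2).pow 2)).add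
        ((h.const_mul 2).mul ((h.const_mul 2).const_sub 2))).smul_const (grad v x)
      norm_num at h1 ⊢
      exact h1

/-- Write `P_e(w, v)` for the pinched function. For test functions `φ_k → v`, `P_e(φ_k, v)` is
bounded by `2|φ_k|`, hence bounded and compactly supported, and also by `|v|`. Letting `k → ∞` with
`e` fixed reaches `P_e(v, v)`, and then `e → 0` reaches `v`; the majorant `|v|` persists throughout.
-/
theorem eq_integral_of_mem_testA (hp' : p ≠ ⊤) (hf : IsCaratheodory Ω f) {u v : W0 Ω p}
    (hv : v ∈ testA f u) {T : StrongDual ℝ (W0 Ω p)} (hT : IsExtension f u T) :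
    T v = ∫ x in Ω, f x (fn u x) * fn v x := by
  refine eq_integral_of_tendsto hf hv T (tendsto_pinch hp' v)
    (fun n => abs_fn_pinch_le hp' (by positivity) v v) fun n => ?_
  obtain ⟨φ, hφ, hφv⟩ := exists_seq_isBoundedCompact v
  have hlim := ((pinch (1 / ((n : ℝ) + 1)) (by positivity)).continuous_app (Ω := Ω) hp').tendsto
    (v, v) |>.comp (hφv.prodMk_nhds (tendsto_const_nhds (x := v)))
  refine eq_integral_of_tendsto hf hv T hlim
    (fun k => abs_fn_pinch_le hp' (by positivity) (φ k) v) fun k => ?_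
  exact eq_integral_of_isBoundedCompact hp' hf hv hT
    (isBoundedCompact_pinch hp' (by positivity) (hφ k) v)
    (abs_fn_pinch_le hp' (by positivity) (φ k) v)

theorem lam_lt_top (hp' : p ≠ ⊤) (hf : IsCaratheodory Ω f) {u : W0 Ω p}
    {T : StrongDual ℝ (W0 Ω p)} (hT : IsExtension f u T) : Lam f u < ⊤ := by
  refine lt_of_le_of_lt (iSup₂_le fun v hv => ?_) (EReal.coe_lt_top ‖T‖)
  rw [← eq_integral_of_mem_testA hp' hf hv.1 hT]
  exact EReal.coe_le_coe_iff.2 ((le_abs_self _).trans (T.unit_le_opNorm v hv.2))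

end

end PLap

end

/-! ### Conclusion -/

theorem mainTheorem4 (N : ℕ) (hN : 1 ≤ N)
    (Ω : Set (EuclideanSpace ℝ (Fin N))) (hΩo : IsOpen Ω) (hΩc : IsConnected Ω)
    (hΩb : Bornology.IsBounded Ω)
    (p : ℝ≥0∞) [Fact (1 ≤ p)] (hp : 1 < p) (hp' : p < ⊤)
    (f : EuclideanSpace ℝ (Fin N) → ℝ → ℝ) (hf : PLap.IsCaratheodory Ω f)
    (hf₀ : PLap.LocalSupIntegrable Ω f)
    (h : StrongDual ℝ (PLap.W0 Ω p)) (u : PLap.W0 Ω p)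
    (hΨ : ∃ r : ℝ, PLap.Psi f u = (r : EReal))
    (hu : PLap.IsCritical (PLap.Phi f h) u) :
    PLap.IsWeakSolution f h u ∧
      ∀ v ∈ PLap.testA f u,
        PLap.pLaplacePairing u v = (∫ x in Ω, f x (PLap.fn u x) * PLap.fn v x) + h v := by
  -- The equation on `V_u` says that `-Δ_p u - h` is an extension; with this choice of `T` the
  -- equation on the whole space is an identity.
  have hT : PLap.IsExtension f u (PLap.pLaplace hp hp'.ne u - h) := fun v hv =>
    ⟨PLap.testV_subset_testA hf hf₀ hv, PLap.eq_of_isCritical hp hp'.ne hf hf₀ hu hv⟩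
  refine ⟨⟨PLap.lam_lt_top hp'.ne hf hT, _, ⟨hT, fun T' hT' => ?_⟩, fun v => ?_⟩, fun v hv => ?_⟩
  · refine ContinuousLinearMap.coeFn_injective ?_
    exact Continuous.ext_on (PLap.dense_testV hp'.ne u) T'.continuous
      (ContinuousLinearMap.continuous _) fun v hv => (hT' v hv).2.trans (hT v hv).2.symm
  · exact (sub_add_cancel _ _).symm
  · exact sub_eq_iff_eq_add.1 (PLap.eq_integral_of_mem_testA hp'.ne hf hv hT)
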